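/- Let $\mathbb D=\{z\in\mathbb C:|z|\le 1\}$, $S^1=\mathbb R/2\pi\mathbb Z$ (coordinate $\theta$), $ST^2=\mathbb D\times S^1$, and let $$D=\begin{pmatrix}\frac1i\frac{\partial}{\partial\theta} & 2\frac{\partial}{\partial\bar z}\\ -2\frac{\partial}{\partial z} & -\frac1i\frac{\partial}{\partial\theta}\end{pmatrix}$$ act, in the sense of distributions on $\{0<|z|<1\}\times S^1$ and without boundary conditions, on the Hilbert space $L^2(ST^2\setminus(\{0\}\times S^1))\otimes\mathbb C^2$. For $F=(f,g)$ in this space write, with $z=re^{i\varphi}$, $$F=\sum_{m,n\in\mathbb Z}\begin{pmatrix}f_{m,n}(r)\\ g_{m,n}(r)\end{pmatrix}e^{in\varphi+im\theta},\qquad f_{m,n}(r)=\frac1{4\pi^2}\int_0^{2\pi}\!\!\int_0^{2\pi}f(re^{i\varphi},\theta)\,e^{-in\varphi-im\theta}\,d\theta\,d\varphi,$$ and similarly for $g_{m,n}$. For $n\in\mathbb Z$ and $t>0$ let $$I_n(t)=\frac1\pi\int_0^\pi e^{t\cos\alpha}\cos(n\alpha)\,d\alpha,\qquad K_n(t)=\int_0^\infty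 e^{-t\cosh\alpha}\cosh(n\alpha)\,d\alpha$$ be the modified Bessel functions of the first and second kind. Then $DF=0$ if and only if there are constants $A_{m,n},B_{m,n}\in\mathbb C$ $(m,n\in\mathbb Z)$ such that, for almost every $r\in(0,1]$: for all $m\ne0$ and all $n\in\mathbb Z$, $$f_{m,n+1}(r)=\frac{m}{|m|}\bigl(-A_{m,n}I_{n+1}(|m|r)+B_{m,n}K_{n+1}(|m|r)\bigr),\qquad g_{m,n}(r)=A_{m,n}I_n(|m|r)+B_{m,n}K_n(|m|r),$$ and for all $n\in\mathbb Z$, $$f_{0,n}(r)=A_{0,n}r^{-n},\qquad g_{0,n}(r)=B_{0,n}r^n.$$ -/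

import Mathlib

open MeasureTheory
open scoped ContDiff

noncomputable section

namespace SolidTorus

instance factTwoPiPos : Fact (0 < 2 * Real.pi) := ⟨Real.two_pi_pos⟩

/-- The circle `S¹ = ℝ / 2πℤ`, with angular coordinate `θ`; its `volume` is `dθ` (total mass `2π`). -/
abbrev S1 : Type := AddCircle (2 * Real.pi)

/-- The solid torus without its core circle, `ST² ∖ ({0} × S¹)`, as a subset of `ℂ × S¹`. -/
def puncturedSolidTorus : Set (ℂ × S1) := {p | 0 < ‖p.1‖ ∧ ‖p.1‖ ≤ 1}

/-- Its interior as a subset of `ℂ × S¹`: the core circle and the boundary torus are removed. -/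
def openPuncturedSolidTorus : Set (ℂ × S1) := {p | 0 < ‖p.1‖ ∧ ‖p.1‖ < 1}

/-- The Hilbert space `L²(ST² ∖ ({0} × S¹)) ⊗ ℂ²`, with respect to Lebesgue measure on `ℂ` times
`dθ` on `S¹`. The components of `F` are `fun p => F p 0` and `fun p => F p 1`. -/
abbrev H : Type :=
  Lp (EuclideanSpace ℂ (Fin 2)) 2 ((volume : Measure (ℂ × S1)).restrict puncturedSolidTorus)

/-- `∂/∂θ` on `ℂ × S¹`. -/
def dTheta (φ : ℂ × S1 → ℂ) (p : ℂ × S1) : ℂ :=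
  deriv (fun t : ℝ => φ (p.1, p.2 + (t : S1))) 0

/-- The Wirtinger derivative `∂/∂z = (∂/∂x - i ∂/∂y) / 2` on `ℂ × S¹`. -/
def dZ (φ : ℂ × S1 → ℂ) (p : ℂ × S1) : ℂ :=
  (fderiv ℝ (fun z : ℂ => φ (z, p.2)) p.1 1
    - Complex.I * fderiv ℝ (fun z : ℂ => φ (z, p.2)) p.1 Complex.I) / 2

/-- The Wirtinger derivative `∂/∂z̄ = (∂/∂x + i ∂/∂y) / 2` on `ℂ × S¹`. -/
def dZbar (φ : ℂ × S1 → ℂ) (p : ℂ × S1) : ℂ :=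
  (fderiv ℝ (fun z : ℂ => φ (z, p.2)) p.1 1
    + Complex.I * fderiv ℝ (fun z : ℂ => φ (z, p.2)) p.1 Complex.I) / 2

/-- Test functions: smooth complex functions on `ℂ × S¹` with compact support inside
`{0 < |z| < 1} × S¹`. -/
structure IsTestFunction (φ : ℂ × S1 → ℂ) : Prop where
  smooth : ContDiff ℝ ∞ (fun p : ℂ × ℝ => φ (p.1, (p.2 : S1)))
  compactSupport : HasCompactSupport φ
  support_subset : tsupport φ ⊆ openPuncturedSolidTorus

/-- The (bilinear) pairing `∫ u φ` over the punctured solid torus of a function with a test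
function. -/
def pairing (u φ : ℂ × S1 → ℂ) : ℂ := ∫ p in puncturedSolidTorus, u p * φ p

/-- `D F = G` for `F = (f, g)` and `G = (p, q)` in `L² ⊗ ℂ²`, in the sense of distributions on the
punctured solid torus and without boundary conditions, where
`D (f, g) = ((1/i) ∂f/∂θ + 2 ∂g/∂z̄, -2 ∂f/∂z - (1/i) ∂g/∂θ)`.
Each distributional derivative is given by `⟨∂u, φ⟩ = -∫ u ∂φ`. -/
def DiracEq (F G : H) : Prop :=
  ∀ φ : ℂ × S1 → ℂ, IsTestFunction φ →
    (1 / Complex.I) * (-pairing (fun x => F x 0) (dTheta φ))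
        + 2 * (-pairing (fun x => F x 1) (dZbar φ)) = pairing (fun x => G x 0) φ ∧
    (-2) * (-pairing (fun x => F x 0) (dZ φ))
        - (1 / Complex.I) * (-pairing (fun x => F x 1) (dTheta φ)) = pairing (fun x => G x 1) φ

/-- The kernel of `D` acting in `L²(ST² ∖ ({0} × S¹)) ⊗ ℂ²`. -/
def diracKernel : Set H := {F | DiracEq F 0}

/-- The Fourier coefficient `u_{m,n}(r)` in `u = ∑ u_{m,n}(r) e^{inα + imθ}`, `z = r e^{iα}`:
`u_{m,n}(r) = (2π)⁻² ∫∫ u(r e^{iα}, θ) e^{-inα - imθ} dα dθ`. -/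
def torusFourierCoeff (u : ℂ × S1 → ℂ) (m n : ℤ) (r : ℝ) : ℂ :=
  1 / (2 * (Real.pi : ℂ)) ^ 2 *
    ∫ α in (0 : ℝ)..(2 * Real.pi), ∫ θ in (0 : ℝ)..(2 * Real.pi),
      u ((r : ℂ) * Complex.exp (α * Complex.I), (θ : S1))
        * Complex.exp (-(n * α + m * θ) * Complex.I)

/-- The modified Bessel function of the first kind `I_n(t)`, of integer order, for `t > 0`. -/
def besselI (n : ℤ) (t : ℝ) : ℝ :=
  1 / Real.pi * ∫ α in (0 : ℝ)..Real.pi, Real.exp (t * Real.cos α) * Real.cos (n * α)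

/-- The modified Bessel function of the second kind `K_n(t)`, of integer order, for `t > 0`. -/
def besselK (n : ℤ) (t : ℝ) : ℝ :=
  ∫ α in Set.Ioi (0 : ℝ), Real.exp (-t * Real.cosh α) * Real.cosh (n * α)

end SolidTorus

end

noncomputable section

namespace SolidTorus

/-! ### Modified Bessel functions of the first kind -/

/-! In polar coordinates `2∂/∂z̄ = e^{iα}(∂_r + (i/r)∂_α)` and `2∂/∂z = e^{-iα}(∂_r - (i/r)∂_α)`, so
`D` couples the mode `(m, n+1)` of `f` only to the mode `(m, n)` of `g`. The equation `DF = 0` is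
thus equivalent to a family of 2×2 radial systems `g' = (n/r) g - m f`, `f' = -((n+1)/r) f - m g` on
`(0, 1)`. No condition at the core or the boundary enters, since test functions vanish near both.

From the kernel to the formulas: testing against `χ(r) e^{-ikα-imθ}` gives the radial system in the
weak sense (`isWeakRadialSolution_componentCoeff`). The system has trace `-1/r`, so `r` times the
determinant of two solutions is constant. For a weak solution paired with a smooth one this is the
du Bois-Reymond lemma (`IsWeakRadialSolution.exists_const`). Pairing with the `I` solution and with
the `K` solution yields two linear equations for `f` and `g`. Their determinant is `r (I_n K_{n+1} +
I_{n+1} K_n)`, a positive constant (`exists_bessel_wronskian`), so Cramer's rule gives the formulas.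
For `m = 0` powers of `r` take the place of Bessel functions.

From the formulas to the kernel: the coefficients are classical solutions, so each radial integral
against a coefficient of a test function is the integral of a derivative and vanishes. To return to
the whole pairing without convergence of a double Fourier series, the test side is rotated by `q` in
the torus. The resulting function of `q` is continuous and all its Fourier coefficients are those
radial integrals, so it vanishes identically, in particular at `q = 0`
(`integral_add_integral_eq_zero_of_fiberCoeff`).

There are countably many modes, so "almost every `r`" may be read mode by mode. -/

theorem hasDerivAt_besselI_aux (n : ℤ) (t : ℝ) :
    HasDerivAt (besselI n) ((besselI (n - 1) t + besselI (n + 1) t) / 2) t := by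
  have key := intervalIntegral.hasDerivAt_integral_of_dominated_loc_of_deriv_le
    (μ := volume) (a := 0) (b := Real.pi) (x₀ := t) (s := Metric.ball t 1)
    (F := fun s α => Real.exp (s * Real.cos α) * Real.cos (n * α))
    (F' := fun s α => Real.exp (s * Real.cos α) * Real.cos α * Real.cos (n * α))
    (bound := fun _ => Real.exp (|t| + 1)) (Metric.ball_mem_nhds t one_pos)
    (Filter.Eventually.of_forall fun s => by
      apply Continuous.aestronglyMeasurable; fun_prop)
    (by apply Continuous.intervalIntegrable; fun_prop)
    (by apply Continuous.aestronglyMeasurable; fun_prop)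
    (by
      refine Filter.Eventually.of_forall fun α _ s hs => ?_
      have h1 : |s| ≤ |t| + 1 := by
        have := abs_sub_abs_le_abs_sub s t
        rw [Metric.mem_ball, Real.dist_eq] at hs
        linarith
      have h2 : s * Real.cos α ≤ |t| + 1 := by
        calc s * Real.cos α ≤ |s * Real.cos α| := le_abs_self _
          _ = |s| * |Real.cos α| := abs_mul _ _
          _ ≤ |s| * 1 := by gcongr; exact Real.abs_cos_le_one α
          _ ≤ |t| + 1 := by linarith
      rw [norm_mul, norm_mul, Real.norm_eq_abs, Real.abs_exp, Real.norm_eq_abs, Real.norm_eq_abs]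
      calc Real.exp (s * Real.cos α) * |Real.cos α| * |Real.cos (n * α)|
          ≤ Real.exp (|t| + 1) * 1 * 1 := by
            gcongr
            · exact Real.abs_cos_le_one _
            · exact Real.abs_cos_le_one _
        _ = _ := by ring)
    (by simp)
    (by
      refine Filter.Eventually.of_forall fun α _ s _ => ?_
      have := (((hasDerivAt_id s).mul_const (Real.cos α)).exp).mul_const (Real.cos (n * α))
      simpa using this)
  have h := key.2.const_mul (1 / Real.pi)
  refine h.congr_deriv ?_
  unfold besselI
  rw [← mul_add, ← intervalIntegral.integral_add
    (by apply Continuous.intervalIntegrable; fun_prop)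
    (by apply Continuous.intervalIntegrable; fun_prop), mul_div_assoc]
  congr 1
  rw [← intervalIntegral.integral_div]
  congr 1
  ext α
  have e1 : ((n - 1 : ℤ) : ℝ) * α = n * α - α := by push_cast; ring
  have e2 : ((n + 1 : ℤ) : ℝ) * α = n * α + α := by push_cast; ring
  rw [e1, e2, Real.cos_sub, Real.cos_add]
  ring

/-- Integrate the derivative of `e^{t cos α} sin(nα)` over `[0, π]`; the boundary terms vanish
because `n` is an integer. -/
theorem besselI_recurrence (n : ℤ) (t : ℝ) :
    t * (besselI (n - 1) t - besselI (n + 1) t) = 2 * n * besselI n t := by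
  have hd : ∀ α : ℝ, HasDerivAt (fun α => Real.exp (t * Real.cos α) * Real.sin (n * α))
      (n * (Real.exp (t * Real.cos α) * Real.cos (n * α))
        - t * (Real.exp (t * Real.cos α) * (Real.sin α * Real.sin (n * α)))) α := by
    intro α
    have h1 := (((Real.hasDerivAt_cos α).const_mul t).exp).mul
      (((hasDerivAt_id α).const_mul (n : ℝ)).sin)
    refine h1.congr_deriv ?_
    simp
    ring
  have h0 := intervalIntegral.integral_eq_sub_of_hasDerivAt (a := 0) (b := Real.pi)
    (fun α _ => hd α) (by apply Continuous.intervalIntegrable; fun_prop)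
  rw [intervalIntegral.integral_sub
    (by apply Continuous.intervalIntegrable; fun_prop)
    (by apply Continuous.intervalIntegrable; fun_prop),
    intervalIntegral.integral_const_mul, intervalIntegral.integral_const_mul] at h0
  simp only [Real.sin_int_mul_pi, mul_zero, Real.sin_zero, sub_zero] at h0
  unfold besselI
  rw [← mul_sub, ← intervalIntegral.integral_sub
    (by apply Continuous.intervalIntegrable; fun_prop)
    (by apply Continuous.intervalIntegrable; fun_prop)]
  have e : ∀ α : ℝ, Real.exp (t * Real.cos α) * Real.cos ((n - 1 : ℤ) * α)
      - Real.exp (t * Real.cos α) * Real.cos ((n + 1 : ℤ) * α)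
      = 2 * (Real.exp (t * Real.cos α) * (Real.sin α * Real.sin (n * α))) := by
    intro α
    have e1 : ((n - 1 : ℤ) : ℝ) * α = n * α - α := by push_cast; ring
    have e2 : ((n + 1 : ℤ) : ℝ) * α = n * α + α := by push_cast; ring
    rw [e1, e2, Real.cos_sub, Real.cos_add]
    ring
  simp_rw [e]
  rw [intervalIntegral.integral_const_mul]
  linear_combination (-2 / Real.pi) * h0

theorem besselI_pred (n : ℤ) {t : ℝ} (ht : 0 < t) :
    besselI (n - 1) t = besselI (n + 1) t + 2 * n / t * besselI n t := by
  have h := besselI_recurrence n t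
  field_simp
  linarith

theorem hasDerivAt_besselI (n : ℤ) {t : ℝ} (ht : 0 < t) :
    HasDerivAt (besselI n) (n / t * besselI n t + besselI (n + 1) t) t := by
  refine (hasDerivAt_besselI_aux n t).congr_deriv ?_
  rw [besselI_pred n ht]
  ring

theorem hasDerivAt_besselI_succ (n : ℤ) {t : ℝ} (ht : 0 < t) :
    HasDerivAt (besselI (n + 1)) (-(n + 1) / t * besselI (n + 1) t + besselI n t) t := by
  refine (hasDerivAt_besselI_aux (n + 1) t).congr_deriv ?_
  have h := besselI_pred (n + 1) ht
  rw [add_sub_cancel_right] at h ⊢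
  push_cast at h
  linear_combination (-1 / 2 : ℝ) * h

theorem besselI_zero_pos (t : ℝ) : 0 < besselI 0 t := by
  unfold besselI
  refine mul_pos (by positivity) ?_
  refine intervalIntegral.intervalIntegral_pos_of_pos_on
    (by apply Continuous.intervalIntegrable; fun_prop) (fun α _ => ?_) Real.pi_pos
  simp [Real.exp_pos]

/-- Since `cos` has integral zero over `[0, π]`, the factor `e^{t cos α}` may be replaced by `e^{t
cos α} - 1`, which has the sign of `cos α`. -/
theorem besselI_one_nonneg {t : ℝ} (ht : 0 < t) : 0 ≤ besselI 1 t := by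
  have h : besselI 1 t
      = 1 / Real.pi * ∫ α in (0 : ℝ)..Real.pi, (Real.exp (t * Real.cos α) - 1) * Real.cos α := by
    unfold besselI
    simp_rw [sub_mul]
    rw [intervalIntegral.integral_sub (by apply Continuous.intervalIntegrable; fun_prop)
      (by apply Continuous.intervalIntegrable; fun_prop)]
    simp
  rw [h]
  refine mul_nonneg (by positivity) (intervalIntegral.integral_nonneg Real.pi_pos.le fun α _ => ?_)
  rcases le_total 0 (Real.cos α) with h | h
  · exact mul_nonneg (by have := Real.one_le_exp (mul_nonneg ht.le h); linarith) h
  · refine mul_nonneg_of_nonpos_of_nonpos ?_ h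
    have := Real.exp_le_one_iff.2 (mul_nonpos_of_nonneg_of_nonpos ht.le h)
    linarith

/-! ### Modified Bessel functions of the second kind -/

/-- The bound `cosh α ≥ α²/4` turns the first factor into a Gaussian, which absorbs any exponential.
This one estimate gives both the integrability and the decay at infinity needed for `besselK`. -/
theorem exp_neg_mul_cosh_mul_cosh_le {t : ℝ} (ht : 0 < t) (ν : ℝ) {α : ℝ} (hα : 0 ≤ α) :
    Real.exp (-t * Real.cosh α) * Real.cosh (ν * α)
      ≤ Real.exp ((|ν| + 1) ^ 2 / t) * Real.exp (-α) := by
  have h1 : α ^ 2 / 4 ≤ Real.cosh α := by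
    have := Real.quadratic_le_exp_of_nonneg hα
    have := Real.exp_pos (-α)
    rw [Real.cosh_eq]
    linarith
  have h2 : Real.cosh (ν * α) ≤ Real.exp (|ν| * α) := by
    rw [← Real.cosh_abs, abs_mul, abs_of_nonneg hα, Real.cosh_eq]
    have : Real.exp (-(|ν| * α)) ≤ Real.exp (|ν| * α) := by
      apply Real.exp_le_exp.2
      have : 0 ≤ |ν| * α := by positivity
      linarith
    linarith
  calc Real.exp (-t * Real.cosh α) * Real.cosh (ν * α)
      ≤ Real.exp (-t * Real.cosh α) * Real.exp (|ν| * α) := by gcongr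
    _ = Real.exp (-t * Real.cosh α + |ν| * α) := (Real.exp_add _ _).symm
    _ ≤ Real.exp ((|ν| + 1) ^ 2 / t + -α) := by
        apply Real.exp_le_exp.2
        -- The constant is the maximum over `α` of `(|ν| + 1) α - t α²/4`, found by completing the
        -- square.
        have h3 : (|ν| + 1) * α ≤ (|ν| + 1) ^ 2 / t + t * (α ^ 2 / 4) := by
          have : (|ν| + 1) ^ 2 / t + t * (α ^ 2 / 4) - (|ν| + 1) * α
              = ((|ν| + 1) - t * α / 2) ^ 2 / t := by
            field_simp; ring
          have : 0 ≤ ((|ν| + 1) - t * α / 2) ^ 2 / t := by positivity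
          linarith
        nlinarith [mul_le_mul_of_nonneg_left h1 ht.le]
    _ = _ := Real.exp_add _ _

theorem integrableOn_exp_neg_mul_cosh_mul_cosh {t : ℝ} (ht : 0 < t) (ν : ℝ) :
    IntegrableOn (fun α => Real.exp (-t * Real.cosh α) * Real.cosh (ν * α)) (Set.Ioi 0) := by
  refine Integrable.mono' (g := fun α => Real.exp ((|ν| + 1) ^ 2 / t) * Real.exp (-α))
    ((integrableOn_exp_neg_Ioi 0).const_mul _)
    (by
      apply Continuous.aestronglyMeasurable
      have := Real.continuous_cosh
      fun_prop) ?_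
  refine (ae_restrict_iff' measurableSet_Ioi).2 (Filter.Eventually.of_forall fun α hα => ?_)
  rw [Real.norm_of_nonneg (by have := Real.cosh_pos (ν * α); positivity)]
  exact exp_neg_mul_cosh_mul_cosh_le ht ν (le_of_lt hα)

theorem cosh_mul_cosh_int (n : ℤ) (α : ℝ) : Real.cosh α * Real.cosh (n * α)
    = (Real.cosh ((n - 1 : ℤ) * α) + Real.cosh ((n + 1 : ℤ) * α)) / 2 := by
  have e1 : ((n - 1 : ℤ) : ℝ) * α = n * α - α := by push_cast; ring
  have e2 : ((n + 1 : ℤ) : ℝ) * α = n * α + α := by push_cast; ring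
  rw [e1, e2, Real.cosh_sub, Real.cosh_add]
  ring

theorem sinh_mul_sinh_int (n : ℤ) (α : ℝ) : Real.sinh α * Real.sinh (n * α)
    = (Real.cosh ((n + 1 : ℤ) * α) - Real.cosh ((n - 1 : ℤ) * α)) / 2 := by
  have e1 : ((n - 1 : ℤ) : ℝ) * α = n * α - α := by push_cast; ring
  have e2 : ((n + 1 : ℤ) : ℝ) * α = n * α + α := by push_cast; ring
  rw [e1, e2, Real.cosh_sub, Real.cosh_add]
  ring

theorem hasDerivAt_besselK_aux (n : ℤ) {t : ℝ} (ht : 0 < t) :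
    HasDerivAt (besselK n) (-(besselK (n - 1) t + besselK (n + 1) t) / 2) t := by
  have hi : ∀ k : ℤ, ∀ {s : ℝ}, 0 < s →
      IntegrableOn (fun α => Real.exp (-s * Real.cosh α) * Real.cosh (k * α)) (Set.Ioi 0) :=
    fun k s hs => integrableOn_exp_neg_mul_cosh_mul_cosh hs k
  have hc := Real.continuous_cosh
  have hsum : ∀ s α : ℝ, Real.exp (-s * Real.cosh α) * (Real.cosh α * Real.cosh (n * α))
      = (Real.exp (-s * Real.cosh α) * Real.cosh ((n - 1 : ℤ) * α)
        + Real.exp (-s * Real.cosh α) * Real.cosh ((n + 1 : ℤ) * α)) / 2 := by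
    intro s α
    rw [cosh_mul_cosh_int]; ring
  -- The integrand decreases in `s`, so on `s > t/2` its value at `t/2` dominates.
  have key := hasDerivAt_integral_of_dominated_loc_of_deriv_le
    (μ := volume.restrict (Set.Ioi (0 : ℝ))) (x₀ := t) (s := Set.Ioi (t / 2))
    (F := fun s α => Real.exp (-s * Real.cosh α) * Real.cosh (n * α))
    (F' := fun s α => -(Real.exp (-s * Real.cosh α) * (Real.cosh α * Real.cosh (n * α))))
    (bound := fun α => Real.exp (-(t / 2) * Real.cosh α) * (Real.cosh α * Real.cosh (n * α)))
    (Ioi_mem_nhds (by linarith))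
    (Filter.Eventually.of_forall fun s => by
      apply Continuous.aestronglyMeasurable; fun_prop)
    (hi n ht)
    (by apply Continuous.aestronglyMeasurable; fun_prop)
    (by
      refine Filter.Eventually.of_forall fun α s hs => ?_
      have h1 := Real.cosh_pos α
      have h2 := Real.cosh_pos (n * α)
      rw [norm_neg, Real.norm_of_nonneg (by positivity)]
      gcongr
      exact le_of_lt hs)
    (by
      simp_rw [hsum]
      exact ((hi (n - 1) (half_pos ht)).add (hi (n + 1) (half_pos ht))).div_const 2)
    (by
      refine Filter.Eventually.of_forall fun α s _ => ?_
      have := ((((hasDerivAt_id s).neg).mul_const (Real.cosh α)).exp).mul_const (Real.cosh (n * α))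
      refine this.congr_deriv ?_
      simp
      ring)
  refine key.2.congr_deriv ?_
  unfold besselK
  rw [← integral_add (hi (n - 1) ht) (hi (n + 1) ht), ← integral_neg, ← integral_div]
  congr 1
  ext α
  rw [hsum]
  ring

/-- Integrate the derivative of `e^{-t cosh α} sinh(nα)` over `(0, ∞)`; it vanishes at `0` and
decays at infinity. -/
theorem besselK_recurrence (n : ℤ) {t : ℝ} (ht : 0 < t) :
    t * (besselK (n + 1) t - besselK (n - 1) t) = 2 * n * besselK n t := by
  have hi : ∀ k : ℤ, ∀ {s : ℝ}, 0 < s →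
      IntegrableOn (fun α => Real.exp (-s * Real.cosh α) * Real.cosh (k * α)) (Set.Ioi 0) :=
    fun k s hs => integrableOn_exp_neg_mul_cosh_mul_cosh hs k
  have hd : ∀ α : ℝ, HasDerivAt (fun α => Real.exp (-t * Real.cosh α) * Real.sinh (n * α))
      (n * (Real.exp (-t * Real.cosh α) * Real.cosh (n * α))
        - t / 2 * (Real.exp (-t * Real.cosh α) * Real.cosh ((n + 1 : ℤ) * α)
          - Real.exp (-t * Real.cosh α) * Real.cosh ((n - 1 : ℤ) * α))) α := by
    intro α
    have h1 := (((Real.hasDerivAt_cosh α).const_mul (-t)).exp).mul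
      (((hasDerivAt_id α).const_mul (n : ℝ)).sinh)
    refine h1.congr_deriv ?_
    have h2 := sinh_mul_sinh_int n α
    simp only [id, mul_one]
    linear_combination (-t * Real.exp (-t * Real.cosh α)) * h2
  have hint := ((hi n ht).const_mul (n : ℝ)).sub
    (((hi (n + 1) ht).sub (hi (n - 1) ht)).const_mul (t / 2))
  have hlim : Filter.Tendsto (fun α => Real.exp (-t * Real.cosh α) * Real.sinh (n * α))
      Filter.atTop (nhds 0) := by
    have h0 : Filter.Tendsto (fun α => Real.exp ((|(n : ℝ)| + 1) ^ 2 / t) * Real.exp (-α))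
        Filter.atTop (nhds 0) := by
      simpa using (Real.tendsto_exp_neg_atTop_nhds_zero).const_mul _
    refine squeeze_zero_norm' ?_ h0
    filter_upwards [Filter.eventually_ge_atTop 0] with α hα
    refine le_trans ?_ (exp_neg_mul_cosh_mul_cosh_le ht n hα)
    rw [norm_mul, Real.norm_eq_abs, Real.abs_exp, Real.norm_eq_abs]
    gcongr
    rw [abs_le]
    have h1 := Real.exp_pos (n * α)
    have h2 := Real.exp_pos (-(n * α))
    rw [Real.cosh_eq, Real.sinh_eq]
    constructor <;> linarith
  have h0 := integral_Ioi_of_hasDerivAt_of_tendsto' (a := 0) (fun α _ => hd α) hint hlim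
  erw [integral_sub ((hi n ht).const_mul (n : ℝ))
    (((hi (n + 1) ht).sub (hi (n - 1) ht)).const_mul (t / 2))] at h0
  rw [integral_const_mul, integral_const_mul] at h0
  erw [integral_sub (hi (n + 1) ht) (hi (n - 1) ht)] at h0
  simp only [mul_zero, Real.sinh_zero, sub_zero] at h0
  unfold besselK
  linear_combination -2 * h0

theorem besselK_pred (n : ℤ) {t : ℝ} (ht : 0 < t) :
    besselK (n - 1) t = besselK (n + 1) t - 2 * n / t * besselK n t := by
  have h := besselK_recurrence n ht
  field_simp
  linarith

theorem hasDerivAt_besselK (n : ℤ) {t : ℝ} (ht : 0 < t) :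
    HasDerivAt (besselK n) (n / t * besselK n t - besselK (n + 1) t) t := by
  refine (hasDerivAt_besselK_aux n ht).congr_deriv ?_
  rw [besselK_pred n ht]
  ring

theorem hasDerivAt_besselK_succ (n : ℤ) {t : ℝ} (ht : 0 < t) :
    HasDerivAt (besselK (n + 1)) (-(n + 1) / t * besselK (n + 1) t - besselK n t) t := by
  refine (hasDerivAt_besselK_aux (n + 1) ht).congr_deriv ?_
  have h := besselK_pred (n + 1) ht
  rw [add_sub_cancel_right] at h ⊢
  push_cast at h
  linear_combination (1 / 2 : ℝ) * h

theorem besselK_pos (n : ℤ) {t : ℝ} (ht : 0 < t) : 0 < besselK n t := by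
  unfold besselK
  have hpos : ∀ α : ℝ, 0 < Real.exp (-t * Real.cosh α) * Real.cosh (n * α) := fun α => by
    have := Real.cosh_pos (n * α)
    positivity
  rw [setIntegral_pos_iff_support_of_nonneg_ae
    (Filter.Eventually.of_forall fun α => (hpos α).le)
    (integrableOn_exp_neg_mul_cosh_mul_cosh ht n)]
  have : Function.support (fun α : ℝ => Real.exp (-t * Real.cosh α) * Real.cosh (n * α))
      = Set.univ := Set.eq_univ_of_forall fun α => (hpos α).ne'
  rw [this]
  simp

/-! ### Smoothness and the Wronskian -/

/-- Bootstrapping: the derivative of each member of the family is a smooth combination of members,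
so `C^k` for all `n` at once implies `C^{k+1}` for all `n`. -/
theorem contDiffOn_infty_of_hasDerivAt_recurrence {f : ℤ → ℝ → ℝ} {a : ℤ → ℝ} {c : ℝ}
    (hf : ∀ n : ℤ, ∀ t : ℝ, 0 < t →
      HasDerivAt (f n) (a n / t * f n t + c * f (n + 1) t) t) (n : ℤ) :
    ContDiffOn ℝ ∞ (f n) (Set.Ioi 0) := by
  rw [contDiffOn_infty]
  intro k
  induction k generalizing n with
  | zero =>
    exact contDiffOn_zero.2 fun t ht => (hf n t ht).continuousAt.continuousWithinAt
  | succ k ih =>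
    push_cast
    rw [contDiffOn_succ_iff_deriv_of_isOpen isOpen_Ioi]
    refine ⟨fun t ht => (hf n t ht).differentiableAt.differentiableWithinAt, by simp, ?_⟩
    refine ContDiffOn.congr (f := fun t => a n / t * f n t + c * f (n + 1) t) ?_
      fun t ht => (hf n t ht).deriv
    exact ((contDiffOn_const.div contDiffOn_id fun t ht => (ne_of_gt ht)).mul (ih n)).add
      (contDiffOn_const.mul (ih (n + 1)))

theorem contDiffOn_besselI (n : ℤ) : ContDiffOn ℝ ∞ (besselI n) (Set.Ioi 0) :=
  contDiffOn_infty_of_hasDerivAt_recurrence (a := fun n => n) (c := 1)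
    (fun n t ht => (hasDerivAt_besselI n ht).congr_deriv (by ring)) n

theorem contDiffOn_besselK (n : ℤ) : ContDiffOn ℝ ∞ (besselK n) (Set.Ioi 0) :=
  contDiffOn_infty_of_hasDerivAt_recurrence (a := fun n => n) (c := -1)
    (fun n t ht => (hasDerivAt_besselK n ht).congr_deriv (by ring)) n

/-- The recurrences for `I` and `K` carry the coefficient `2(n+1)/t` with opposite signs, so the
extra terms cancel. Positivity of the Wronskian is then only needed for `n = 0`, where `I_0 > 0`,
`I_1 ≥ 0` and `K > 0` suffice. -/
theorem bessel_wronskian_succ (n : ℤ) {t : ℝ} (ht : 0 < t) :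
    besselI (n + 1) t * besselK (n + 1 + 1) t + besselI (n + 1 + 1) t * besselK (n + 1) t
      = besselI n t * besselK (n + 1) t + besselI (n + 1) t * besselK n t := by
  have h1 := besselI_pred (n + 1) ht
  have h2 := besselK_pred (n + 1) ht
  rw [add_sub_cancel_right] at h1 h2
  rw [h1, h2]
  ring

theorem bessel_wronskian_pos (n : ℤ) {t : ℝ} (ht : 0 < t) :
    0 < besselI n t * besselK (n + 1) t + besselI (n + 1) t * besselK n t := by
  have h0 : 0 < besselI 0 t * besselK (0 + 1) t + besselI (0 + 1) t * besselK 0 t :=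
    add_pos_of_pos_of_nonneg (mul_pos (besselI_zero_pos t) (besselK_pos _ ht))
      (mul_nonneg (besselI_one_nonneg ht) (besselK_pos _ ht).le)
  induction n using Int.induction_on with
  | zero => exact h0
  | succ k ih => rw [bessel_wronskian_succ _ ht]; exact ih
  | pred k ih =>
    have h := bessel_wronskian_succ (-(k : ℤ) - 1) ht
    rw [sub_add_cancel] at h ⊢
    rw [← h]
    exact ih

/-- The first-order equations make the derivative of this product zero. Cramer's rule only needs a
nonzero constant, so its value is not computed. -/
theorem exists_bessel_wronskian (n : ℤ) : ∃ w : ℝ, 0 < w ∧ ∀ t : ℝ, 0 < t →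
    t * (besselI n t * besselK (n + 1) t + besselI (n + 1) t * besselK n t) = w := by
  have hd : ∀ t ∈ Set.Ioi (0 : ℝ), HasDerivAt
      (fun t => t * (besselI n t * besselK (n + 1) t + besselI (n + 1) t * besselK n t)) 0 t := by
    intro t ht
    have ht' : (0 : ℝ) < t := ht
    refine ((hasDerivAt_id t).mul (((hasDerivAt_besselI n ht').mul
      (hasDerivAt_besselK_succ n ht')).add ((hasDerivAt_besselI_succ n ht').mul
      (hasDerivAt_besselK n ht')))).congr_deriv ?_
    simp only [id, Pi.add_apply, Pi.mul_apply]
    field_simp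
    ring
  refine ⟨1 * (besselI n 1 * besselK (n + 1) 1 + besselI (n + 1) 1 * besselK n 1),
    mul_pos one_pos (bessel_wronskian_pos n one_pos), fun t ht => ?_⟩
  exact isOpen_Ioi.is_const_of_deriv_eq_zero isPreconnected_Ioi
    (fun s hs => (hd s hs).differentiableAt.differentiableWithinAt)
    (fun s hs => (hd s hs).deriv) (show t ∈ Set.Ioi (0 : ℝ) from ht)
    (Set.mem_Ioi.2 one_pos)

/-! ### The radial equations in the weak sense -/

theorem exists_Icc_of_isCompact_subset_Ioo {a b : ℝ} (hab : a < b) {K : Set ℝ} (hK : IsCompact K)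
    (hKs : K ⊆ Set.Ioo a b) : ∃ a' b', a < a' ∧ a' ≤ b' ∧ b' < b ∧ K ⊆ Set.Icc a' b' := by
  rcases K.eq_empty_or_nonempty with rfl | hne
  · exact ⟨(a + b) / 2, (a + b) / 2, by linarith, le_rfl, by linarith, Set.empty_subset _⟩
  · have h1 := hK.sInf_mem hne
    have h2 := hK.sSup_mem hne
    exact ⟨sInf K, sSup K, (hKs h1).1, csInf_le hK.bddBelow h2, (hKs h2).2,
      fun x hx => ⟨csInf_le hK.bddBelow hx, le_csSup hK.bddAbove hx⟩⟩

/-- The primitive starting at `a` vanishes to the left of the support, and to the right of it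
because the total integral is zero. -/
theorem exists_primitive_of_integral_eq_zero {a b : ℝ} (hab : a < b) {ζ : ℝ → ℝ}
    (hζ : ContDiff ℝ ∞ ζ) (hc : HasCompactSupport ζ) (hs : tsupport ζ ⊆ Set.Ioo a b)
    (h0 : ∫ x, ζ x = 0) : ∃ η : ℝ → ℝ, ContDiff ℝ ∞ η ∧ HasCompactSupport η ∧
      tsupport η ⊆ Set.Ioo a b ∧ deriv η = ζ := by
  obtain ⟨a', b', h1, h2, h3, h4⟩ := exists_Icc_of_isCompact_subset_Ioo hab hc hs
  have hz : ∀ x, x ∉ Set.Icc a' b' → ζ x = 0 := fun x hx =>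
    image_eq_zero_of_notMem_tsupport fun h => hx (h4 h)
  have hd : ∀ x, HasDerivAt (fun x => ∫ y in a..x, ζ y) (ζ x) x := fun x =>
    intervalIntegral.integral_hasDerivAt_right (hζ.continuous.intervalIntegrable _ _)
      hζ.continuous.aestronglyMeasurable.stronglyMeasurableAtFilter hζ.continuous.continuousAt
  have hderiv : deriv (fun x => ∫ y in a..x, ζ y) = ζ := funext fun x => (hd x).deriv
  have hsupp : tsupport (fun x => ∫ y in a..x, ζ y) ⊆ Set.Icc a' b' := by
    refine closure_minimal (fun x hx => ?_) isClosed_Icc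
    by_contra hx'
    apply hx
    rcases lt_or_ge x a' with h | h
    · refine intervalIntegral.integral_zero_ae (Filter.Eventually.of_forall fun y hy => ?_)
      refine hz y fun hy' => ?_
      have h5 : y ≤ max a x := (Set.mem_Ioc.1 hy).2
      have h6 : max a x < a' := max_lt h1 h
      linarith [hy'.1]
    · have h5 : b' < x := by
        by_contra h6
        exact hx' ⟨h, not_lt.1 h6⟩
      change ∫ y in a..x, ζ y = 0
      rw [intervalIntegral.integral_eq_integral_of_support_subset, h0]
      intro y hy
      by_contra hy'
      refine hy (hz y fun hy2 => hy' ⟨by linarith [hy2.1], by linarith [hy2.2]⟩)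
  refine ⟨_, ?_, isCompact_Icc.of_isClosed_subset (isClosed_tsupport _) hsupp,
    fun x hx => ⟨by linarith [(hsupp hx).1], by linarith [(hsupp hx).2]⟩, hderiv⟩
  rw [contDiff_infty_iff_deriv, hderiv]
  exact ⟨fun x => (hd x).differentiableAt, hζ⟩

theorem integrable_mul_of_locallyIntegrableOn {U : Set ℝ} {u : ℝ → ℂ}
    (hu : LocallyIntegrableOn u U) {χ : ℝ → ℝ} (hχ : Continuous χ) (hc : HasCompactSupport χ)
    (hs : tsupport χ ⊆ U) : Integrable (fun x => u x * (χ x : ℂ)) := by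
  obtain ⟨C, hC⟩ := hχ.bounded_above_of_compact_support hc
  rw [← integrableOn_iff_integrable_of_support_subset (s := tsupport χ)]
  · refine (hu.integrableOn_compact_subset hs hc).mul_bdd (c := C) ?_
      (Filter.Eventually.of_forall fun x => ?_)
    · exact (Complex.continuous_ofReal.comp hχ).aestronglyMeasurable
    · simpa using hC x
  · intro x hx
    apply subset_tsupport
    intro h
    apply hx
    simp [h]

/-- The lemma of du Bois-Reymond on an interval. -/
theorem ae_eq_const_of_integral_mul_deriv_eq_zero {a b : ℝ} (hab : a < b) {u : ℝ → ℂ}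
    (hu : LocallyIntegrableOn u (Set.Ioo a b))
    (h : ∀ η : ℝ → ℝ, ContDiff ℝ ∞ η → HasCompactSupport η → tsupport η ⊆ Set.Ioo a b →
      ∫ x, u x * ((deriv η x : ℝ) : ℂ) = 0) :
    ∃ c : ℂ, ∀ᵐ x, x ∈ Set.Ioo a b → u x = c := by
  -- A bump of integral 1 whose support, of radius `(b - a)/4` about the midpoint, stays inside the
  -- interval. The constant will be the mean of `u` against it.
  let β : ContDiffBump ((a + b) / 2) := ⟨(b - a) / 8, (b - a) / 4, by linarith, by linarith⟩
  let β' := β.normed volume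
  have hβ1 : ContDiff ℝ ∞ β' := β.contDiff_normed
  have hβ2 : HasCompactSupport β' := β.hasCompactSupport_normed
  have hβ3 : tsupport β' ⊆ Set.Ioo a b := by
    rw [β.tsupport_normed_eq, Real.closedBall_eq_Icc]
    intro x hx
    have h1 : (a + b) / 2 - (b - a) / 4 ≤ x := hx.1
    have h2 : x ≤ (a + b) / 2 + (b - a) / 4 := hx.2
    exact ⟨by linarith, by linarith⟩
  have hβ4 : ∫ x, β' x = 1 := β.integral_normed
  refine ⟨∫ x, u x * (β' x : ℂ), ?_⟩
  set c := ∫ x, u x * (β' x : ℂ) with hc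
  have hc' : LocallyIntegrableOn (fun _ : ℝ => c) (Set.Ioo a b) :=
    (locallyIntegrable_const c).locallyIntegrableOn _
  have := isOpen_Ioo.ae_eq_zero_of_integral_contDiff_smul_eq_zero (f := fun x => u x - c)
    (hu.sub hc') fun χ hχ1 hχ2 hχ3 => ?_
  · filter_upwards [this] with x hx hx'
    exact sub_eq_zero.1 (hx hx')
  have hci : Integrable χ := hχ1.continuous.integrable_of_hasCompactSupport hχ2
  have hbi : Integrable β' := hβ1.continuous.integrable_of_hasCompactSupport hβ2
  have hsub : tsupport (fun x => χ x - (∫ y, χ y) * β' x) ⊆ tsupport χ ∪ tsupport β' := by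
    refine closure_minimal (fun x hx => ?_) ((isClosed_tsupport _).union (isClosed_tsupport _))
    by_contra hx'
    rw [Set.mem_union, not_or] at hx'
    apply hx
    simp [image_eq_zero_of_notMem_tsupport hx'.1, image_eq_zero_of_notMem_tsupport hx'.2]
  -- Subtracting `(∫ χ) β'` from an arbitrary test function `χ` leaves mean zero, hence the
  -- derivative of a test function, to which `h` applies.
  obtain ⟨η, hη1, hη2, hη3, hη4⟩ := exists_primitive_of_integral_eq_zero hab
    (ζ := fun x => χ x - (∫ y, χ y) * β' x) (hχ1.sub (contDiff_const.mul hβ1))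
    ((hχ2.isCompact.union hβ2.isCompact).of_isClosed_subset (isClosed_tsupport _) hsub)
    (hsub.trans (Set.union_subset hχ3 hβ3))
    (by rw [integral_sub hci (hbi.const_mul _), integral_const_mul, hβ4]; simp)
  have h1 := h η hη1 hη2 hη3
  have i1 := integrable_mul_of_locallyIntegrableOn hu hχ1.continuous hχ2 hχ3
  have i2 := integrable_mul_of_locallyIntegrableOn hu hβ1.continuous hβ2 hβ3
  have e1 : ∀ x, u x * ((deriv η x : ℝ) : ℂ)
      = u x * (χ x : ℂ) - ((∫ y, χ y : ℝ) : ℂ) * (u x * (β' x : ℂ)) := by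
    intro x
    rw [hη4]; push_cast; ring
  simp_rw [e1] at h1
  rw [integral_sub i1 (i2.const_mul _), integral_const_mul, ← hc] at h1
  have e2 : ∀ x, χ x • (u x - c) = u x * (χ x : ℂ) - (χ x : ℂ) * c := by
    intro x
    rw [Complex.real_smul]; ring
  have i3 : Integrable (fun x => ((χ x : ℝ) : ℂ) * c) := hci.ofReal.mul_const c
  simp_rw [e2]
  rw [integral_sub i1 i3, integral_mul_const, integral_complex_ofReal]
  exact h1

/-- Weak form on `(0, 1)` of the radial system `g' = (n / r) g - m f`,
`f' = -((n + 1) / r) f - m g`. -/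
structure IsWeakRadialSolution (m n : ℤ) (f g : ℝ → ℂ) : Prop where
  fst : ∀ χ : ℝ → ℝ, ContDiff ℝ ∞ χ → HasCompactSupport χ → tsupport χ ⊆ Set.Ioo 0 1 →
    ∫ r : ℝ in Set.Ioc 0 1, (f r * ((m * (r * χ r) : ℝ) : ℂ)
      - g r * ((r * deriv χ r + (n + 1) * χ r : ℝ) : ℂ)) = 0
  snd : ∀ χ : ℝ → ℝ, ContDiff ℝ ∞ χ → HasCompactSupport χ → tsupport χ ⊆ Set.Ioo 0 1 →
    ∫ r : ℝ in Set.Ioc 0 1, (f r * ((r * deriv χ r - n * χ r : ℝ) : ℂ)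
      - g r * ((m * (r * χ r) : ℝ) : ℂ)) = 0

theorem ae_inv_mul_mul_cancel (f : ℝ → ℂ) :
    (fun r : ℝ => (r : ℂ)⁻¹ * ((r : ℂ) * f r)) =ᵐ[volume] f := by
  have h : ∀ᵐ r : ℝ, r ≠ 0 := compl_mem_ae_iff.2 (measure_singleton 0)
  filter_upwards [h] with r hr
  have : (r : ℂ) ≠ 0 := by exact_mod_cast hr
  field_simp

/-- Polar coordinates only provide integrability with the weight `r`; away from `0` the factor `1/r`
is continuous and the weight can be removed. -/
theorem locallyIntegrableOn_of_integrableOn_mul {f : ℝ → ℂ}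
    (hf : IntegrableOn (fun r : ℝ => (r : ℂ) * f r) (Set.Ioc 0 1)) :
    LocallyIntegrableOn f (Set.Ioo 0 1) := by
  have h1 : LocallyIntegrableOn (fun r : ℝ => (r : ℂ) * f r) (Set.Ioo 0 1) :=
    (hf.mono_set Set.Ioo_subset_Ioc_self).locallyIntegrableOn
  have h2 := h1.continuousOn_mul (g := fun r : ℝ => (r : ℂ)⁻¹)
    (Complex.continuous_ofReal.continuousOn.inv₀ fun r hr => by
      exact_mod_cast (ne_of_gt hr.1)) isOpen_Ioo.isLocallyClosed
  intro x hx
  obtain ⟨s, hs, hsi⟩ := h2 x hx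
  exact ⟨s, hs, hsi.congr (ae_restrict_of_ae (ae_inv_mul_mul_cancel f))⟩

theorem contDiff_mul_of_tsupport_subset {U : Set ℝ} (hU : IsOpen U) {p η : ℝ → ℝ}
    (hp : ContDiffOn ℝ ∞ p U) (hη : ContDiff ℝ ∞ η) (hs : tsupport η ⊆ U) :
    ContDiff ℝ ∞ (fun r => p r * η r) := by
  rw [contDiff_iff_contDiffAt]
  intro x
  by_cases hx : x ∈ tsupport η
  · exact (hp.contDiffAt (hU.mem_nhds (hs hx))).mul hη.contDiffAt
  · refine contDiffAt_const (c := (0 : ℝ)).congr_of_eventuallyEq ?_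
    filter_upwards [(isClosed_tsupport η).isOpen_compl.mem_nhds hx] with y hy
    simp [image_eq_zero_of_notMem_tsupport hy]

theorem tsupport_mul_subset_right' (p η : ℝ → ℝ) : tsupport (fun r => p r * η r) ⊆ tsupport η :=
  closure_mono fun x hx h => hx (by simp [h])

theorem integrable_mul_deriv_add {U : Set ℝ} {u : ℝ → ℂ} (hu : LocallyIntegrableOn u U)
    {χ α β : ℝ → ℝ} (hχ : ContDiff ℝ ∞ χ) (hc : HasCompactSupport χ) (hs : tsupport χ ⊆ U)
    (hα : Continuous α) (hβ : Continuous β) :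
    Integrable (fun r => u r * ((α r * deriv χ r + β r * χ r : ℝ) : ℂ)) := by
  have hsub : tsupport (fun r => α r * deriv χ r + β r * χ r) ⊆ tsupport χ := by
    refine closure_minimal (fun x hx => ?_) (isClosed_tsupport _)
    by_contra hx'
    apply hx
    simp [image_eq_zero_of_notMem_tsupport hx',
      image_eq_zero_of_notMem_tsupport fun h => hx' (tsupport_deriv_subset h)]
  have := hχ.continuous
  have := hχ.continuous_deriv (by simp)
  exact integrable_mul_of_locallyIntegrableOn hu (by fun_prop)
    (hc.of_isClosed_subset (isClosed_tsupport _) hsub) (hsub.trans hs)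

theorem deriv_eq_zero_of_notMem_tsupport {η : ℝ → ℝ} {x : ℝ} (hx : x ∉ tsupport η) :
    deriv η x = 0 :=
  image_eq_zero_of_notMem_tsupport fun h => hx (tsupport_deriv_subset h)

/-- The hypotheses on `p`, `q` say that `(-t q, p)` is a classical solution of the same system. Up
to the sign `-t`, the conserved quantity is `r` times its determinant with `(f, g)`. The choices `t
= ±1` cover both Bessel families, whose derivatives differ by the sign of `c`. -/
theorem IsWeakRadialSolution.exists_const {m n : ℤ} {f g : ℝ → ℂ} (h : IsWeakRadialSolution m n f g)
    (hf : IntegrableOn (fun r : ℝ => (r : ℂ) * f r) (Set.Ioc 0 1))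
    (hg : IntegrableOn (fun r : ℝ => (r : ℂ) * g r) (Set.Ioc 0 1)) {p q : ℝ → ℝ} {c t : ℝ}
    (hps : ContDiffOn ℝ ∞ p (Set.Ioi 0)) (hqs : ContDiffOn ℝ ∞ q (Set.Ioi 0))
    (hp : ∀ r, 0 < r → HasDerivAt p (n / r * p r + c * q r) r)
    (hq : ∀ r, 0 < r → HasDerivAt q (-(n + 1) / r * q r + c * p r) r)
    (ht : t * t = 1) (hc : c = t * m) :
    ∃ a : ℂ, ∀ᵐ r : ℝ ∂(volume.restrict (Set.Ioc (0 : ℝ) 1)),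
      (r : ℂ) * (g r * (q r : ℂ) + t * f r * (p r : ℂ)) = a := by
  have hfl := locallyIntegrableOn_of_integrableOn_mul hf
  have hgl := locallyIntegrableOn_of_integrableOn_mul hg
  have hsub : Set.Ioo (0 : ℝ) 1 ⊆ Set.Ioi 0 := fun x hx => hx.1
  have hcont : ∀ k : ℝ → ℝ, ContDiffOn ℝ ∞ k (Set.Ioi 0) →
      ContinuousOn (fun r : ℝ => ((r * k r : ℝ) : ℂ)) (Set.Ioo 0 1) := fun k hk =>
    Complex.continuous_ofReal.comp_continuousOn (continuousOn_id.mul (hk.continuousOn.mono hsub))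
  have hu : LocallyIntegrableOn (fun r : ℝ => g r * ((r * q r : ℝ) : ℂ)
      + t * (f r * ((r * p r : ℝ) : ℂ))) (Set.Ioo 0 1) := by
    refine (hgl.mul_continuousOn (hcont q hqs) isOpen_Ioo.isLocallyClosed).add ?_
    exact (hfl.mul_continuousOn (hcont p hps) isOpen_Ioo.isLocallyClosed).continuousOn_mul
      continuousOn_const isOpen_Ioo.isLocallyClosed
  suffices hdb : ∀ η : ℝ → ℝ, ContDiff ℝ ∞ η → HasCompactSupport η → tsupport η ⊆ Set.Ioo 0 1 →
      ∫ r : ℝ, (g r * ((r * q r : ℝ) : ℂ) + t * (f r * ((r * p r : ℝ) : ℂ)))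
        * ((deriv η r : ℝ) : ℂ) = 0 by
    obtain ⟨a, ha⟩ := ae_eq_const_of_integral_mul_deriv_eq_zero one_pos hu hdb
    refine ⟨a, ?_⟩
    rw [← restrict_Ioo_eq_restrict_Ioc, ae_restrict_iff' measurableSet_Ioo]
    filter_upwards [ha] with r hr hr'
    rw [← hr hr']
    push_cast; ring
  intro η hη1 hη2 hη3
  have hη0 := hη3.trans hsub
  have hsmooth : ∀ k : ℝ → ℝ, ContDiffOn ℝ ∞ k (Set.Ioi 0) →
      ContDiff ℝ ∞ (fun r => k r * η r) ∧ HasCompactSupport (fun r => k r * η r) ∧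
        tsupport (fun r => k r * η r) ⊆ Set.Ioo 0 1 := fun k hk =>
    ⟨contDiff_mul_of_tsupport_subset isOpen_Ioi hk hη1 hη0,
      hη2.of_isClosed_subset (isClosed_tsupport _) (tsupport_mul_subset_right' k η),
      (tsupport_mul_subset_right' k η).trans hη3⟩
  obtain ⟨q1, q2, q3⟩ := hsmooth q hqs
  obtain ⟨p1, p2, p3⟩ := hsmooth p hps
  have hzero : ∀ k : ℝ → ℝ, tsupport k ⊆ Set.Ioo 0 1 → ∀ r ∉ Set.Ioc (0 : ℝ) 1,
      k r = 0 ∧ deriv k r = 0 := fun k hk r hr => by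
    have : r ∉ tsupport k := fun h' => hr (Set.Ioo_subset_Ioc_self (hk h'))
    exact ⟨image_eq_zero_of_notMem_tsupport this, deriv_eq_zero_of_notMem_tsupport this⟩
  -- The weak equations are tested with `q η` and `p η`.
  have w1 := h.fst _ q1 q2 q3
  have w2 := h.snd _ p1 p2 p3
  rw [setIntegral_eq_integral_of_forall_compl_eq_zero fun r hr => by
    simp [hzero _ q3 r hr]] at w1
  rw [setIntegral_eq_integral_of_forall_compl_eq_zero fun r hr => by
    simp [hzero _ p3 r hr]] at w2
  have hd : ∀ {k : ℝ → ℝ} {d r : ℝ}, HasDerivAt k d r →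
      deriv (fun r => k r * η r) r = d * η r + k r * deriv η r := fun hk =>
    (hk.mul (hη1.differentiable (by simp)).differentiableAt.hasDerivAt).deriv
  have i1 : Integrable (fun r : ℝ => f r * ((m * (r * (q r * η r)) : ℝ) : ℂ)
      - g r * ((r * deriv (fun r => q r * η r) r + (n + 1) * (q r * η r) : ℝ) : ℂ)) := by
    refine Integrable.sub ?_ ?_
    · refine (integrable_mul_deriv_add hfl q1 q2 q3 (α := fun _ => 0) (β := fun r => m * r)
        (by fun_prop) (by fun_prop)).congr (Filter.Eventually.of_forall fun r => ?_)
      simp only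
      congr 2
      ring
    · exact integrable_mul_deriv_add hgl q1 q2 q3 (α := fun r => r) (β := fun r => n + 1)
        (by fun_prop) (by fun_prop)
  have i2 : Integrable (fun r : ℝ =>
      f r * ((r * deriv (fun r => p r * η r) r - n * (p r * η r) : ℝ) : ℂ)
      - g r * ((m * (r * (p r * η r)) : ℝ) : ℂ)) := by
    refine Integrable.sub ?_ ?_
    · refine (integrable_mul_deriv_add hfl p1 p2 p3 (α := fun r => r) (β := fun r => -n)
        (by fun_prop) (by fun_prop)).congr (Filter.Eventually.of_forall fun r => ?_)
      simp only
      congr 2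
      ring
    · refine (integrable_mul_deriv_add hgl p1 p2 p3 (α := fun _ => 0) (β := fun r => m * r)
        (by fun_prop) (by fun_prop)).congr (Filter.Eventually.of_forall fun r => ?_)
      simp only
      congr 2
      ring
  -- In `t` times the second equation minus the first, the equations for `p` and `q` cancel every
  -- term containing `η` undifferentiated; only the `deriv η` terms survive.
  have hfin : ∫ r : ℝ, ((t : ℂ) * (f r * ((r * deriv (fun r => p r * η r) r
        - n * (p r * η r) : ℝ) : ℂ) - g r * ((m * (r * (p r * η r)) : ℝ) : ℂ))
      - (f r * ((m * (r * (q r * η r)) : ℝ) : ℂ)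
        - g r * ((r * deriv (fun r => q r * η r) r + (n + 1) * (q r * η r) : ℝ) : ℂ))) = 0 := by
    rw [integral_sub (i2.const_mul _) i1, integral_const_mul, w1, w2]
    simp
  rw [← hfin]
  congr 1
  ext r
  -- The equations for `p` and `q` are only available for `r > 0`; elsewhere all test functions
  -- vanish.
  rcases le_or_gt r 0 with hr | hr
  · have hr' : r ∉ Set.Ioc (0 : ℝ) 1 := fun h' => absurd h'.1 (not_lt.2 hr)
    simp [hzero _ q3 r hr', hzero _ p3 r hr', hzero _ hη3 r hr']
  · rw [hd (hp r hr), hd (hq r hr)]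
    have ht' : (t : ℂ) * t = 1 := by exact_mod_cast ht
    have hr' : (r : ℂ) ≠ 0 := by exact_mod_cast hr.ne'
    rw [hc]
    push_cast
    field_simp
    linear_combination (-(m * q r * f r * η r * r : ℂ)) * ht'

/-! ### Explicit form of the weak radial solutions -/

theorem hasDerivAt_comp_const_mul {u : ℝ → ℝ} {d c r : ℝ} (h : HasDerivAt u d (c * r)) :
    HasDerivAt (fun r => u (c * r)) (c * d) r := by
  have := HasDerivAt.comp r h ((hasDerivAt_id r).const_mul c)
  exact this.congr_deriv (by ring)

theorem contDiffOn_comp_const_mul {u : ℝ → ℝ} {c : ℝ} (hc : 0 < c)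
    (h : ContDiffOn ℝ ∞ u (Set.Ioi 0)) : ContDiffOn ℝ ∞ (fun r => u (c * r)) (Set.Ioi 0) :=
  h.comp (contDiffOn_const.mul contDiffOn_id) fun _ hr => mul_pos hc hr

section ScaledBessel

variable (n : ℤ) {c r : ℝ}

theorem hasDerivAt_besselI_mul (hc : 0 < c) (hr : 0 < r) :
    HasDerivAt (fun r => besselI n (c * r))
      (n / r * besselI n (c * r) + c * besselI (n + 1) (c * r)) r := by
  refine (hasDerivAt_comp_const_mul (hasDerivAt_besselI n (mul_pos hc hr))).congr_deriv ?_
  field_simp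

theorem hasDerivAt_besselI_succ_mul (hc : 0 < c) (hr : 0 < r) :
    HasDerivAt (fun r => besselI (n + 1) (c * r))
      (-(n + 1) / r * besselI (n + 1) (c * r) + c * besselI n (c * r)) r := by
  refine (hasDerivAt_comp_const_mul (hasDerivAt_besselI_succ n (mul_pos hc hr))).congr_deriv ?_
  field_simp

theorem hasDerivAt_besselK_mul (hc : 0 < c) (hr : 0 < r) :
    HasDerivAt (fun r => besselK n (c * r))
      (n / r * besselK n (c * r) + -c * besselK (n + 1) (c * r)) r := by
  refine (hasDerivAt_comp_const_mul (hasDerivAt_besselK n (mul_pos hc hr))).congr_deriv ?_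
  field_simp
  ring

theorem hasDerivAt_besselK_succ_mul (hc : 0 < c) (hr : 0 < r) :
    HasDerivAt (fun r => besselK (n + 1) (c * r))
      (-(n + 1) / r * besselK (n + 1) (c * r) + -c * besselK n (c * r)) r := by
  refine (hasDerivAt_comp_const_mul (hasDerivAt_besselK_succ n (mul_pos hc hr))).congr_deriv ?_
  field_simp
  ring

end ScaledBessel

/-- Pairing with the `I` solution isolates the coefficient `B`, and pairing with the `K` solution
isolates `A`; the Wronskian is the determinant of the two equations. -/
theorem IsWeakRadialSolution.exists_bessel {m n : ℤ} (hm : m ≠ 0) {f g : ℝ → ℂ}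
    (h : IsWeakRadialSolution m n f g)
    (hf : IntegrableOn (fun r : ℝ => (r : ℂ) * f r) (Set.Ioc 0 1))
    (hg : IntegrableOn (fun r : ℝ => (r : ℂ) * g r) (Set.Ioc 0 1)) :
    ∃ A B : ℂ, ∀ᵐ r : ℝ ∂(volume.restrict (Set.Ioc 0 1)),
      f r = ((m : ℂ) / ((|(m : ℝ)| : ℝ) : ℂ)) *
        (-A * (besselI (n + 1) (|(m : ℝ)| * r) : ℂ)
          + B * (besselK (n + 1) (|(m : ℝ)| * r) : ℂ)) ∧
      g r = A * (besselI n (|(m : ℝ)| * r) : ℂ) + B * (besselK n (|(m : ℝ)| * r) : ℂ) := by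
  have hm' : (m : ℝ) ≠ 0 := by exact_mod_cast hm
  set μ : ℝ := |(m : ℝ)| with hμdef
  have hμ : 0 < μ := abs_pos.2 hm'
  have hμ2 : μ * μ = m * m := abs_mul_abs_self _
  have ht : (m / μ : ℝ) * (m / μ) = 1 := by field_simp; rw [sq, sq, hμ2]
  have hc : μ = m / μ * m := by field_simp; rw [sq, sq, hμ2]
  obtain ⟨b, hb⟩ := h.exists_const hf hg (contDiffOn_comp_const_mul hμ (contDiffOn_besselI n))
    (contDiffOn_comp_const_mul hμ (contDiffOn_besselI (n + 1)))
    (fun r hr => hasDerivAt_besselI_mul n hμ hr)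
    (fun r hr => hasDerivAt_besselI_succ_mul n hμ hr) ht hc
  obtain ⟨a, ha⟩ := h.exists_const hf hg (t := -(m / μ))
    (contDiffOn_comp_const_mul hμ (contDiffOn_besselK n))
    (contDiffOn_comp_const_mul hμ (contDiffOn_besselK (n + 1)))
    (fun r hr => hasDerivAt_besselK_mul n hμ hr)
    (fun r hr => hasDerivAt_besselK_succ_mul n hμ hr) (by rw [neg_mul_neg, ht])
    (by rw [neg_mul, ← hc])
  obtain ⟨w, hw, hwr⟩ := exists_bessel_wronskian n
  -- The Wronskian identity is used at `μ r`, so the determinant with weight `r` is `w / μ`.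
  refine ⟨μ * a / w, μ * b / w, ?_⟩
  filter_upwards [ha, hb, ae_restrict_mem measurableSet_Ioc] with r har hbr hr
  have hwc : ((μ : ℂ) * r) * ((besselI n (μ * r) : ℂ) * (besselK (n + 1) (μ * r) : ℂ)
      + (besselI (n + 1) (μ * r) : ℂ) * (besselK n (μ * r) : ℂ)) = w := by
    exact_mod_cast hwr (μ * r) (mul_pos hμ hr.1)
  have hw0 : (w : ℂ) ≠ 0 := by exact_mod_cast hw.ne'
  have hμ0 : (μ : ℂ) ≠ 0 := by exact_mod_cast hμ.ne'
  rw [← har, ← hbr]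
  push_cast
  have ht' : ((m : ℂ) / μ) * (m / μ) = 1 := by exact_mod_cast ht
  -- From here only `s² = 1` matters.
  generalize (m : ℂ) / μ = s at *
  constructor
  · field_simp
    rw [← hwc]
    linear_combination (-(μ * r * f r * ((besselI n (μ * r) : ℂ) * (besselK (n + 1) (μ * r) : ℂ)
      + (besselI (n + 1) (μ * r) : ℂ) * (besselK n (μ * r) : ℂ)))) * ht'
  · field_simp
    rw [← hwc]
    ring

theorem contDiffOn_zpow_Ioi (n : ℤ) : ContDiffOn ℝ ∞ (fun r : ℝ => r ^ n) (Set.Ioi 0) := by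
  obtain ⟨k, rfl | rfl⟩ := n.eq_nat_or_neg
  · simp only [zpow_natCast]
    exact contDiffOn_id.pow k
  · simp only [zpow_neg, zpow_natCast]
    exact (contDiffOn_id.pow k).inv fun r hr => pow_ne_zero _ (ne_of_gt hr)

/-- For `m = 0` the system decouples: the pairs `(r^n, 0)` and `(0, r^{-(n+1)})` show that `r^{n+1}
f` and `r^{-n} g` are constant. -/
theorem IsWeakRadialSolution.exists_zpow {n : ℤ} {f g : ℝ → ℂ}
    (h : IsWeakRadialSolution 0 n f g)
    (hf : IntegrableOn (fun r : ℝ => (r : ℂ) * f r) (Set.Ioc 0 1))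
    (hg : IntegrableOn (fun r : ℝ => (r : ℂ) * g r) (Set.Ioc 0 1)) :
    ∃ A B : ℂ, ∀ᵐ r : ℝ ∂(volume.restrict (Set.Ioc 0 1)),
      f r = A * (r : ℂ) ^ (-(n + 1)) ∧ g r = B * (r : ℂ) ^ n := by
  obtain ⟨a, ha⟩ := h.exists_const hf hg (p := fun r => r ^ n) (q := fun _ => 0) (c := 0) (t := 1)
    (contDiffOn_zpow_Ioi n) contDiffOn_const
    (fun r hr => (hasDerivAt_zpow n r (Or.inl hr.ne')).congr_deriv (by
      rw [zpow_sub_one₀ hr.ne']; field_simp; ring))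
    (fun r hr => (hasDerivAt_const r (0 : ℝ)).congr_deriv (by ring)) (by ring) (by simp)
  obtain ⟨b, hb⟩ := h.exists_const hf hg (p := fun _ => 0) (q := fun r => r ^ (-(n + 1)))
    (c := 0) (t := 1) contDiffOn_const (contDiffOn_zpow_Ioi (-(n + 1)))
    (fun r hr => (hasDerivAt_const r (0 : ℝ)).congr_deriv (by ring))
    (fun r hr => (hasDerivAt_zpow _ r (Or.inl hr.ne')).congr_deriv (by
      rw [zpow_sub_one₀ hr.ne']; push_cast; field_simp; ring)) (by ring) (by simp)
  refine ⟨a, b, ?_⟩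
  filter_upwards [ha, hb, ae_restrict_mem measurableSet_Ioc] with r har hbr hr
  have hr0 : (r : ℂ) ≠ 0 := by exact_mod_cast hr.1.ne'
  have e : (r : ℂ) ^ (-(n + 1)) * (r : ℂ) ^ n * r = 1 := by
    rw [← zpow_add₀ hr0, ← zpow_add_one₀ hr0]
    simp
  rw [← har, ← hbr]
  push_cast
  constructor
  · linear_combination (-f r) * e
  · linear_combination (-g r) * e

/-! ### Classical solutions of the radial equations -/

/-- Classical solutions on `(0, ∞)` of the radial system `g' = (n / r) g - m f`,
`f' = -((n + 1) / r) f - m g`. -/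
structure IsRadialSolution (m n : ℤ) (f g : ℝ → ℂ) : Prop where
  fst : ∀ r : ℝ, 0 < r → HasDerivAt f (-(n + 1) / r * f r - m * g r) r
  snd : ∀ r : ℝ, 0 < r → HasDerivAt g (n / r * g r - m * f r) r

theorem isRadialSolution_bessel {m : ℤ} (hm : m ≠ 0) (n : ℤ) (A B : ℂ) :
    IsRadialSolution m n
      (fun r => ((m : ℂ) / ((|(m : ℝ)| : ℝ) : ℂ)) *
        (-A * (besselI (n + 1) (|(m : ℝ)| * r) : ℂ)
          + B * (besselK (n + 1) (|(m : ℝ)| * r) : ℂ)))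
      (fun r => A * (besselI n (|(m : ℝ)| * r) : ℂ) + B * (besselK n (|(m : ℝ)| * r) : ℂ)) := by
  have hm' : (m : ℝ) ≠ 0 := by exact_mod_cast hm
  set μ : ℝ := |(m : ℝ)| with hμdef
  have hμ : 0 < μ := abs_pos.2 hm'
  have hμ2r : μ * μ = m * m := abs_mul_abs_self _
  have hμ2 : (μ : ℂ) * μ = m * m := by exact_mod_cast hμ2r
  have hμ0 : (μ : ℂ) ≠ 0 := by exact_mod_cast hμ.ne'
  constructor
  · intro r hr
    have hr0 : (r : ℂ) ≠ 0 := by exact_mod_cast hr.ne'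
    refine ((((hasDerivAt_besselI_succ_mul n hμ hr).ofReal_comp.const_mul (-A)).add
      ((hasDerivAt_besselK_succ_mul n hμ hr).ofReal_comp.const_mul B)).const_mul _).congr_deriv ?_
    push_cast
    field_simp
    ring
  · intro r hr
    have hr0 : (r : ℂ) ≠ 0 := by exact_mod_cast hr.ne'
    refine (((hasDerivAt_besselI_mul n hμ hr).ofReal_comp.const_mul A).add
      ((hasDerivAt_besselK_mul n hμ hr).ofReal_comp.const_mul B)).congr_deriv ?_
    push_cast
    field_simp
    linear_combination (r * (A * (besselI (n + 1) (μ * r) : ℂ)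
      - B * (besselK (n + 1) (μ * r) : ℂ))) * hμ2

theorem hasDerivAt_ofReal_zpow (n : ℤ) {r : ℝ} (hr : 0 < r) :
    HasDerivAt (fun r : ℝ => (r : ℂ) ^ n) (n / r * (r : ℂ) ^ n) r := by
  have hr0 : (r : ℂ) ≠ 0 := by exact_mod_cast hr.ne'
  refine (hasDerivAt_zpow n (r : ℂ) (Or.inl hr0)).comp_ofReal.congr_deriv ?_
  rw [zpow_sub_one₀ hr0]
  field_simp

theorem isRadialSolution_zpow (n : ℤ) (A B : ℂ) :
    IsRadialSolution 0 n (fun r => A * (r : ℂ) ^ (-(n + 1))) (fun r => B * (r : ℂ) ^ n) := by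
  constructor
  · intro r hr
    refine ((hasDerivAt_ofReal_zpow _ hr).const_mul A).congr_deriv ?_
    push_cast
    ring
  · intro r hr
    refine ((hasDerivAt_ofReal_zpow _ hr).const_mul B).congr_deriv ?_
    push_cast
    ring

/-- Since `h` vanishes near `0`, so does `h'`, and the fundamental theorem is applied on `[ε/2, 1]`
only; `h'` may be uncontrolled at `0`. Halving `ε` leaves room for a neighbourhood on which `h` is
zero. -/
theorem setIntegral_deriv_eq_zero {h h' : ℝ → ℂ} {ε : ℝ} (hε : 0 < ε) (hε1 : ε < 1)
    (hd : ∀ r, 0 < r → HasDerivAt h (h' r) r) (hc : ContinuousOn h' (Set.Ioi 0))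
    (h0 : ∀ r, 0 < r → r ≤ ε → h r = 0) (h1 : h 1 = 0) :
    ∫ r in Set.Ioc (0 : ℝ) 1, h' r = 0 := by
  have hz : ∀ r ∈ Set.Ioc (0 : ℝ) (ε / 2), h' r = 0 := by
    intro r hr
    have h2 : h =ᶠ[nhds r] fun _ => 0 := by
      filter_upwards [Ioo_mem_nhds hr.1 (show r < ε by linarith [hr.2])] with s hs
      exact h0 s hs.1 hs.2.le
    exact ((hd r hr.1).congr_of_eventuallyEq h2.symm).unique (hasDerivAt_const r 0)
  have hsub : Set.uIcc (ε / 2) 1 ⊆ Set.Ioi 0 := by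
    rw [Set.uIcc_of_le (by linarith)]
    exact fun r hr => lt_of_lt_of_le (by linarith) hr.1
  have hi : IntervalIntegrable h' volume (ε / 2) 1 := (hc.mono hsub).intervalIntegrable
  rw [← Set.Ioc_union_Ioc_eq_Ioc (show (0 : ℝ) ≤ ε / 2 by linarith)
    (show ε / 2 ≤ 1 by linarith), setIntegral_union (by
      rw [Set.disjoint_left]; intro x hx hx'; exact absurd hx'.1 (not_lt.2 hx.2)) measurableSet_Ioc
    ((integrableOn_zero).congr_fun (fun r hr => (hz r hr).symm) measurableSet_Ioc)
    ((intervalIntegrable_iff_integrableOn_Ioc_of_le (by linarith)).1 hi),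
    setIntegral_congr_fun measurableSet_Ioc hz,
    ← intervalIntegral.integral_of_le (show ε / 2 ≤ 1 by linarith),
    intervalIntegral.integral_eq_sub_of_hasDerivAt (fun r hr => hd r (hsub hr)) hi, h1,
    h0 (ε / 2) (by linarith) (by linarith)]
  simp

section

variable {m n : ℤ} {f g χ χ' : ℝ → ℂ} {ε : ℝ}

/-- The integrand is the derivative of `-r g χ`; in the companion for the second equation it is that
of `r f χ`. Here `χ` is complex because it will be a Fourier coefficient of a test function. -/
theorem IsRadialSolution.integral_fst (h : IsRadialSolution m n f g) (hε : 0 < ε) (hε1 : ε < 1)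
    (hd : ∀ r, 0 < r → HasDerivAt χ (χ' r) r) (hc : ContinuousOn χ' (Set.Ioi 0))
    (h0 : ∀ r, 0 < r → r ≤ ε → χ r = 0) (h1 : χ 1 = 0) :
    ∫ r : ℝ in Set.Ioc 0 1, (f r * (m * (r * χ r)) - g r * (r * χ' r + (n + 1) * χ r)) = 0 := by
  have hfc : ContinuousOn f (Set.Ioi 0) := fun r hr => (h.fst r hr).continuousAt.continuousWithinAt
  have hgc : ContinuousOn g (Set.Ioi 0) := fun r hr => (h.snd r hr).continuousAt.continuousWithinAt
  have hχc : ContinuousOn χ (Set.Ioi 0) := fun r hr => (hd r hr).continuousAt.continuousWithinAt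
  refine setIntegral_deriv_eq_zero (h := fun r : ℝ => -(g r * (r * χ r))) hε hε1 (fun r hr => ?_)
    (by fun_prop) (fun r hr hr' => by simp [h0 r hr hr']) (by simp [h1])
  have hr0 : (r : ℂ) ≠ 0 := by exact_mod_cast hr.ne'
  refine ((h.snd r hr).mul (((hasDerivAt_id r).ofReal_comp).mul (hd r hr))).neg.congr_deriv ?_
  simp
  field_simp
  ring

theorem IsRadialSolution.integral_snd (h : IsRadialSolution m n f g) (hε : 0 < ε) (hε1 : ε < 1)
    (hd : ∀ r, 0 < r → HasDerivAt χ (χ' r) r) (hc : ContinuousOn χ' (Set.Ioi 0))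
    (h0 : ∀ r, 0 < r → r ≤ ε → χ r = 0) (h1 : χ 1 = 0) :
    ∫ r : ℝ in Set.Ioc 0 1, (f r * (r * χ' r - n * χ r) - g r * (m * (r * χ r))) = 0 := by
  have hfc : ContinuousOn f (Set.Ioi 0) := fun r hr => (h.fst r hr).continuousAt.continuousWithinAt
  have hgc : ContinuousOn g (Set.Ioi 0) := fun r hr => (h.snd r hr).continuousAt.continuousWithinAt
  have hχc : ContinuousOn χ (Set.Ioi 0) := fun r hr => (hd r hr).continuousAt.continuousWithinAt
  refine setIntegral_deriv_eq_zero (h := fun r : ℝ => f r * (r * χ r)) hε hε1 (fun r hr => ?_)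
    (by fun_prop) (fun r hr hr' => by simp [h0 r hr hr']) (by simp [h1])
  have hr0 : (r : ℂ) ≠ 0 := by exact_mod_cast hr.ne'
  refine ((h.fst r hr).mul (((hasDerivAt_id r).ofReal_comp).mul (hd r hr))).congr_deriv ?_
  simp
  field_simp
  ring

end

/-! ### Polar coordinates on the punctured solid torus -/

theorem fourier_coe_two_pi (n : ℤ) (x : ℝ) :
    fourier n (x : S1) = Complex.exp (n * x * Complex.I) := by
  rw [fourier_coe_apply]
  congr 1
  have : (Real.pi : ℂ) ≠ 0 := by exact_mod_cast Real.pi_ne_zero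
  push_cast
  field_simp

/-- The map `(r, α, θ) ↦ (r e^{iα}, θ)`. -/
def polarMap (p : ℝ × S1 × S1) : ℂ × S1 := ((p.1 : ℂ) * fourier 1 p.2.1, p.2.2)

/-- The measure `r dr` on `(0, 1]`. -/
def radialMeasure : Measure ℝ :=
  (volume.restrict (Set.Ioc 0 1)).withDensity fun r => ENNReal.ofReal r

/-- The measure `r dr dα dθ` on `(0, 1] × S¹ × S¹`. -/
def polarMeasure : Measure (ℝ × S1 × S1) := radialMeasure.prod volume

instance isFiniteMeasure_radialMeasure : IsFiniteMeasure radialMeasure := by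
  exact isFiniteMeasure_withDensity_ofReal
    ((continuous_id.integrableOn_Icc (a := (0 : ℝ)) (b := 1)).mono_set Set.Ioc_subset_Icc_self).2

instance isFiniteMeasure_polarMeasure : IsFiniteMeasure polarMeasure := by
  unfold polarMeasure; infer_instance

theorem continuous_polarMap : Continuous polarMap := by
  unfold polarMap
  fun_prop

theorem norm_fourier (n : ℤ) (x : S1) : ‖fourier n x‖ = 1 := by
  rw [fourier_apply]; exact Circle.norm_coe _

theorem norm_polarMap_fst (p : ℝ × S1 × S1) : ‖(polarMap p).1‖ = |p.1| := by
  rw [polarMap, norm_mul, norm_fourier]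
  simp

theorem continuous_polarCoord_symm_complex :
    Continuous (fun p : ℝ × ℝ => Complex.polarCoord.symm p) := by
  simp only [Complex.polarCoord_symm_apply]
  fun_prop

theorem measurePreserving_polar_plane :
    MeasurePreserving (fun p : ℝ × S1 => (p.1 : ℂ) * fourier 1 p.2) (radialMeasure.prod volume)
      (volume.restrict {z : ℂ | 0 < ‖z‖ ∧ ‖z‖ ≤ 1}) := by
  have hm : Measurable (fun p : ℝ × S1 => (p.1 : ℂ) * fourier 1 p.2) :=
    Continuous.measurable (by fun_prop)
  have hA : MeasurableSet {z : ℂ | 0 < ‖z‖ ∧ ‖z‖ ≤ 1} :=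
    (measurableSet_lt measurable_const measurable_norm).inter
      (measurableSet_le measurable_norm measurable_const)
  refine ⟨hm, Measure.ext_of_lintegral _ fun f hf => ?_⟩
  rw [lintegral_map hf hm, lintegral_prod (fun p : ℝ × S1 => f ((p.1 : ℂ) * fourier 1 p.2))
      (hf.comp hm).aemeasurable, radialMeasure,
    lintegral_withDensity_eq_lintegral_mul _ (by fun_prop)
      (Measurable.lintegral_prod_right' (f := fun p : ℝ × S1 => f ((p.1 : ℂ) * fourier 1 p.2))
        (hf.comp hm)),
    ← lintegral_indicator hA, ← Complex.lintegral_comp_polarCoord_symm]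
  have ht : (polarCoord.target : Set (ℝ × ℝ)) = Set.Ioi 0 ×ˢ Set.Ioo (-Real.pi) Real.pi := rfl
  rw [ht, Measure.volume_eq_prod, ← Measure.prod_restrict, lintegral_prod]
  · rw [← Set.Ioc_union_Ioi_eq_Ioi (zero_le_one' ℝ), lintegral_union measurableSet_Ioi
      (by rw [Set.disjoint_left]; intro x hx hx'; exact absurd hx'.out (not_lt.2 hx.2))]
    -- Radii beyond 1 contribute nothing because of the indicator.
    have e2 : ∫⁻ r in Set.Ioi (1 : ℝ), ∫⁻ a in Set.Ioo (-Real.pi) Real.pi,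
        ENNReal.ofReal (r, a).1 • ({z : ℂ | 0 < ‖z‖ ∧ ‖z‖ ≤ 1}.indicator f)
          (Complex.polarCoord.symm (r, a)) = 0 := by
      rw [setLIntegral_congr_fun (g := fun _ => 0) measurableSet_Ioi]
      · simp
      · intro r hr
        have hr' : (1 : ℝ) < r := hr
        simp only
        rw [lintegral_eq_zero_of_ae_eq_zero]
        refine Filter.Eventually.of_forall fun a => ?_
        have : Complex.polarCoord.symm (r, a) ∉ {z : ℂ | 0 < ‖z‖ ∧ ‖z‖ ≤ 1} := by
          intro h
          have := h.2
          rw [Complex.norm_polarCoord_symm] at this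
          simp only at this
          rw [abs_of_pos (by linarith)] at this
          linarith
        simp only [Set.indicator_of_notMem this, smul_zero, Pi.zero_apply]
    rw [e2, add_zero]
    refine setLIntegral_congr_fun measurableSet_Ioc fun r hr => ?_
    simp only [Pi.mul_apply]
    -- The circle is unrolled onto `(-π, π]`, which differs from the open interval of the polar
    -- chart by a null set.
    rw [← AddCircle.lintegral_preimage (2 * Real.pi) (-Real.pi),
      show -Real.pi + 2 * Real.pi = Real.pi by ring, ← restrict_Ioo_eq_restrict_Ioc,
      ← lintegral_const_mul]
    · refine lintegral_congr fun a => ?_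
      have e3 : Complex.polarCoord.symm (r, a) = (r : ℂ) * fourier 1 (a : S1) := by
        rw [fourier_coe_two_pi, Complex.polarCoord_symm_apply]
        simp [Complex.exp_mul_I]
      rw [e3, Set.indicator_of_mem]
      · rfl
      · rw [Set.mem_ofPred_eq, norm_mul, norm_fourier, mul_one, Complex.norm_real,
          Real.norm_of_nonneg hr.1.le]
        exact hr
    · have : Continuous fun a : ℝ => (a : S1) := AddCircle.continuous_mk' _
      exact hf.comp (Continuous.measurable (by fun_prop))
  · refine Measurable.aemeasurable ?_
    have h1 := continuous_polarCoord_symm_complex.measurable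
    exact (ENNReal.measurable_ofReal.comp measurable_fst).smul ((hf.indicator hA).comp h1)

theorem measurePreserving_polarMap :
    MeasurePreserving polarMap polarMeasure (volume.restrict puncturedSolidTorus) := by
  have h1 := (measurePreserving_polar_plane.prod (MeasurePreserving.id (volume : Measure S1))).comp
    (MeasurePreserving.symm _ (measurePreserving_prodAssoc radialMeasure (volume : Measure S1)
      (volume : Measure S1)))
  have h2 : (volume.restrict {z : ℂ | 0 < ‖z‖ ∧ ‖z‖ ≤ 1}).prod (volume : Measure S1)
      = volume.restrict puncturedSolidTorus := by
    rw [← Measure.restrict_univ (μ := (volume : Measure S1)), Measure.prod_restrict,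
      ← Measure.volume_eq_prod]
    congr 1
    ext p
    simp [puncturedSolidTorus]
  rw [h2] at h1
  exact h1

theorem integral_polarMeasure {E : Type*} [NormedAddCommGroup E] [NormedSpace ℝ E]
    {w : ℝ × S1 × S1 → E} (hw : Integrable w polarMeasure) :
    ∫ p, w p ∂polarMeasure = ∫ r in Set.Ioc (0 : ℝ) 1, r • ∫ q : S1 × S1, w (r, q) := by
  unfold polarMeasure at *
  rw [integral_prod _ hw, radialMeasure, integral_withDensity_eq_integral_toReal_smul (by fun_prop)
    (by simp)]
  refine setIntegral_congr_fun measurableSet_Ioc fun r hr => ?_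
  rw [ENNReal.toReal_ofReal hr.1.le]

theorem ae_of_ae_radialMeasure {P : ℝ → Prop} (h : ∀ᵐ r ∂radialMeasure, P r) :
    ∀ᵐ r ∂(volume.restrict (Set.Ioc (0 : ℝ) 1)), P r := by
  unfold radialMeasure at h
  rw [ae_withDensity_iff (by fun_prop)] at h
  filter_upwards [h, ae_restrict_mem measurableSet_Ioc] with r hr hr'
  exact hr (by simpa using hr'.1)

theorem integrableOn_of_integrable_radialMeasure {u : ℝ → ℂ} (h : Integrable u radialMeasure) :
    IntegrableOn (fun r : ℝ => (r : ℂ) * u r) (Set.Ioc 0 1) := by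
  unfold radialMeasure at h
  rw [integrable_withDensity_iff_integrable_smul' (by fun_prop) (by simp)] at h
  refine h.congr ?_
  filter_upwards [ae_restrict_mem measurableSet_Ioc] with r hr
  rw [ENNReal.toReal_ofReal hr.1.le, Complex.real_smul]

/-! ### Fourier coefficients on the fibres -/

/-- The character `(α, θ) ↦ e^{inα + imθ}` of the torus. -/
def torusChar (m n : ℤ) (q : S1 × S1) : ℂ := fourier n q.1 * fourier m q.2

theorem continuous_torusChar (m n : ℤ) : Continuous (torusChar m n) := by
  unfold torusChar; fun_prop

theorem norm_torusChar (m n : ℤ) (q : S1 × S1) : ‖torusChar m n q‖ = 1 := by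
  rw [torusChar, norm_mul, norm_fourier, norm_fourier, one_mul]

theorem torusChar_add (m n : ℤ) (p q : S1 × S1) :
    torusChar m n (p + q) = torusChar m n p * torusChar m n q := by
  simp only [torusChar, fourier_apply, Prod.fst_add, Prod.snd_add, smul_add,
    AddCircle.toCircle_add, Circle.coe_mul]
  ring

theorem torusChar_neg_mul_self (m n : ℤ) (q : S1 × S1) :
    torusChar (-m) (-n) q * torusChar m n q = 1 := by
  have h : ∀ (k : ℤ) (x : S1), fourier (-k) x * fourier k x = 1 := fun k x => by
    rw [← fourier_add]; simp
  rw [torusChar, torusChar, mul_mul_mul_comm, h, h, one_mul]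

/-- The (unnormalized) Fourier coefficient of the restriction of `U` to the torus of radius `r`. -/
def fiberCoeff (U : ℝ × S1 × S1 → ℂ) (m n : ℤ) (r : ℝ) : ℂ :=
  ∫ q : S1 × S1, U (r, q) * torusChar (-m) (-n) q

theorem fiberCoeff_mul_fourier (U : ℝ × S1 × S1 → ℂ) (k m n : ℤ) (r : ℝ) :
    fiberCoeff (fun p => U p * fourier k p.2.1) m n r = fiberCoeff U m (n - k) r := by
  unfold fiberCoeff torusChar
  congr 1
  ext q
  rw [show -(n - k) = k + -n by ring, fourier_add]
  ring

theorem ae_integrable_fiber {U : ℝ × S1 × S1 → ℂ} (hU : Integrable U polarMeasure) :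
    ∀ᵐ r ∂(volume.restrict (Set.Ioc (0 : ℝ) 1)), Integrable fun q => U (r, q) :=
  ae_of_ae_radialMeasure hU.prod_right_ae

theorem integrable_mul_torusChar {U : ℝ × S1 × S1 → ℂ} (hU : Integrable U polarMeasure) {h : ℝ → ℂ}
    (hh : Continuous h) {C : ℝ} (hC : ∀ r, ‖h r‖ ≤ C) (m n : ℤ) :
    Integrable (fun p : ℝ × S1 × S1 => U p * (h p.1 * torusChar m n p.2)) polarMeasure := by
  have := continuous_torusChar m n
  refine hU.mul_bdd (c := C) (Continuous.aestronglyMeasurable (by fun_prop))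
    (Filter.Eventually.of_forall fun p => ?_)
  rw [norm_mul, norm_torusChar, mul_one]
  exact hC _

theorem integral_mul_torusChar {U : ℝ × S1 × S1 → ℂ} (hU : Integrable U polarMeasure) {h : ℝ → ℂ}
    (hh : Continuous h) {C : ℝ} (hC : ∀ r, ‖h r‖ ≤ C) (m n : ℤ) :
    ∫ p, U p * (h p.1 * torusChar (-m) (-n) p.2) ∂polarMeasure
      = ∫ r : ℝ in Set.Ioc 0 1, r * h r * fiberCoeff U m n r := by
  rw [integral_polarMeasure (integrable_mul_torusChar hU hh hC _ _)]
  refine integral_congr_ae (Filter.Eventually.of_forall fun r => ?_)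
  simp only
  rw [Complex.real_smul, fiberCoeff, ← integral_const_mul, ← integral_const_mul]
  refine integral_congr_ae (Filter.Eventually.of_forall fun q => ?_)
  simp only
  ring

theorem integrableOn_mul_fiberCoeff {U : ℝ × S1 × S1 → ℂ} (hU : Integrable U polarMeasure)
    (m n : ℤ) : IntegrableOn (fun r : ℝ => (r : ℂ) * fiberCoeff U m n r) (Set.Ioc 0 1) := by
  refine integrableOn_of_integrable_radialMeasure ?_
  have := (integrable_mul_torusChar hU (h := fun _ => 1) continuous_const (C := 1)
    (fun _ => by simp) (-m) (-n)).integral_prod_left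
  simp only [one_mul] at this
  exact this

theorem integrableOn_mul_mul_fiberCoeff {U : ℝ × S1 × S1 → ℂ} (hU : Integrable U polarMeasure)
    (m n : ℤ) {h : ℝ → ℂ} (hh : Continuous h) {C : ℝ} (hC : ∀ r, ‖h r‖ ≤ C) :
    IntegrableOn (fun r : ℝ => (r : ℂ) * h r * fiberCoeff U m n r) (Set.Ioc 0 1) := by
  refine ((integrableOn_mul_fiberCoeff hU m n).bdd_mul (c := C) hh.aestronglyMeasurable
    (Filter.Eventually.of_forall hC)).congr (Filter.Eventually.of_forall fun r => ?_)
  simp only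
  ring

theorem fiberCoeff_const_mul (U : ℝ × S1 × S1 → ℂ) (c : ℂ) (m n : ℤ) (r : ℝ) :
    fiberCoeff (fun p => c * U p) m n r = c * fiberCoeff U m n r := by
  unfold fiberCoeff
  simp only [mul_assoc, integral_const_mul]

theorem torusFourierCoeff_eq_integral (u : ℂ × S1 → ℂ) (m n : ℤ) (r : ℝ) :
    torusFourierCoeff u m n r = 1 / (2 * (Real.pi : ℂ)) ^ 2 *
      ∫ x : S1, ∫ y : S1, u (polarMap (r, x, y)) * torusChar (-m) (-n) (x, y) := by
  unfold torusFourierCoeff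
  congr 1
  rw [← AddCircle.intervalIntegral_preimage (2 * Real.pi) 0, zero_add]
  refine intervalIntegral.integral_congr fun α _ => ?_
  rw [← AddCircle.intervalIntegral_preimage (2 * Real.pi) 0, zero_add]
  refine intervalIntegral.integral_congr fun θ _ => ?_
  simp only [polarMap, torusChar, fourier_coe_two_pi]
  rw [← Complex.exp_add]
  push_cast
  congr 3
  · simp
  · ring

/-- The coefficient in the theorem is an iterated integral; it agrees with the double integral on
those tori where `u` is integrable, hence for almost every radius. -/
theorem ae_torusFourierCoeff_eq {u : ℂ × S1 → ℂ}
    (hu : Integrable (fun p => u (polarMap p)) polarMeasure) (m n : ℤ) :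
    ∀ᵐ r ∂(volume.restrict (Set.Ioc (0 : ℝ) 1)), torusFourierCoeff u m n r
      = 1 / (2 * (Real.pi : ℂ)) ^ 2 * fiberCoeff (fun p => u (polarMap p)) m n r := by
  filter_upwards [ae_integrable_fiber hu] with r hr
  rw [torusFourierCoeff_eq_integral, fiberCoeff, Measure.volume_eq_prod, integral_prod]
  refine hr.mul_bdd (c := 1) (continuous_torusChar _ _).aestronglyMeasurable
    (Filter.Eventually.of_forall fun p => ?_)
  rw [norm_torusChar]

theorem memLp_component (F : H) (i : Fin 2) :
    MemLp (fun x => F x i) 2 (volume.restrict puncturedSolidTorus) :=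
  ((EuclideanSpace.proj (𝕜 := ℂ) i : EuclideanSpace ℂ (Fin 2) →L[ℂ] ℂ)).comp_memLp' (Lp.memLp F)

theorem integrable_component_polarMap (F : H) (i : Fin 2) :
    Integrable (fun p => F (polarMap p) i) polarMeasure :=
  ((memLp_component F i).comp_measurePreserving measurePreserving_polarMap).integrable
    (by norm_num)

theorem pairing_eq_integral_polarMeasure (F : H) (i : Fin 2) {φ : ℂ × S1 → ℂ} (hφ : Continuous φ) :
    pairing (fun x => F x i) φ
      = ∫ p, F (polarMap p) i * φ (polarMap p) ∂polarMeasure := by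
  have h := (memLp_component F i).1.mul hφ.aestronglyMeasurable
  have hmap := measurePreserving_polarMap.map_eq
  have h1 := integral_map (μ := polarMeasure) continuous_polarMap.aemeasurable
    (f := fun x => F x i * φ x) (hmap.symm ▸ h)
  rw [hmap] at h1
  exact h1

theorem ae_polarMeasure_pos : ∀ᵐ p ∂polarMeasure, 0 < p.1 := by
  have h : ∀ᵐ r ∂radialMeasure, 0 < r :=
    (withDensity_absolutelyContinuous _ _).ae_le
      ((ae_restrict_mem measurableSet_Ioc).mono fun r hr => hr.1)
  exact Measure.quasiMeasurePreserving_fst.ae h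

/-! ### Test functions in polar coordinates -/

/-- The covering `ℝ → S¹` is open, so its product with the identity is still a quotient map. This
brings regularity, stated on `ℂ × ℝ` for test functions, down to `ℂ × S¹`. -/
theorem continuous_of_continuous_comp_coe {X Y : Type*} [TopologicalSpace X] [TopologicalSpace Y]
    {f : X × S1 → Y} (h : Continuous fun p : X × ℝ => f (p.1, (p.2 : S1))) : Continuous f := by
  have hq : Topology.IsQuotientMap (Prod.map (id : X → X) (fun t : ℝ => (t : S1))) :=
    (IsOpenMap.id.prodMap QuotientAddGroup.isOpenMap_coe).isQuotientMap
      (continuous_id.prodMap (AddCircle.continuous_mk' _))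
      (Function.surjective_id.prodMap QuotientAddGroup.mk_surjective)
  exact hq.continuous_iff.2 h

namespace IsTestFunction

variable {φ : ℂ × S1 → ℂ}

theorem continuous (h : IsTestFunction φ) : Continuous φ :=
  continuous_of_continuous_comp_coe h.smooth.continuous

theorem hasFDerivAt_slice (h : IsTestFunction φ) (z : ℂ) (t : ℝ) :
    HasFDerivAt (fun z => φ (z, (t : S1)))
      ((fderiv ℝ (fun p : ℂ × ℝ => φ (p.1, (p.2 : S1))) (z, t)).comp
        (ContinuousLinearMap.inl ℝ ℂ ℝ)) z :=
  HasFDerivAt.comp z (f := fun z => (z, t)) (g := fun p : ℂ × ℝ => φ (p.1, (p.2 : S1)))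
    ((h.smooth.differentiable (by simp)) (z, t)).hasFDerivAt (hasFDerivAt_prodMk_left z t)

theorem differentiableAt_slice (h : IsTestFunction φ) (z : ℂ) (y : S1) :
    DifferentiableAt ℝ (fun z => φ (z, y)) z := by
  induction y using QuotientAddGroup.induction_on with
  | H t => exact (h.hasFDerivAt_slice z t).differentiableAt

theorem hasDerivAt_dTheta_coe (h : IsTestFunction φ) (z : ℂ) (t : ℝ) :
    HasDerivAt (fun s : ℝ => φ (z, (t : S1) + (s : S1)))
      (fderiv ℝ (fun p : ℂ × ℝ => φ (p.1, (p.2 : S1))) (z, t) (0, 1)) 0 := by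
  have h1 : HasDerivAt (fun s : ℝ => (z, t + s)) ((0 : ℂ), (1 : ℝ)) 0 :=
    (hasDerivAt_const _ _).prodMk ((hasDerivAt_id (0 : ℝ)).const_add t)
  have h2 : HasFDerivAt (fun p : ℂ × ℝ => φ (p.1, (p.2 : S1)))
      (fderiv ℝ (fun p : ℂ × ℝ => φ (p.1, (p.2 : S1))) (z, t)) (z, t + 0) := by
    rw [add_zero]
    exact ((h.smooth.differentiable (by simp)) (z, t)).hasFDerivAt
  exact h2.comp_hasDerivAt (0 : ℝ) h1

theorem hasDerivAt_dTheta (h : IsTestFunction φ) (z : ℂ) (y : S1) :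
    HasDerivAt (fun s : ℝ => φ (z, y + (s : S1))) (dTheta φ (z, y)) 0 := by
  induction y using QuotientAddGroup.induction_on with
  | H t => exact (h.hasDerivAt_dTheta_coe z t).differentiableAt.hasDerivAt

theorem continuous_dTheta (h : IsTestFunction φ) : Continuous (dTheta φ) := by
  refine continuous_of_continuous_comp_coe ?_
  have : (fun p : ℂ × ℝ => dTheta φ (p.1, (p.2 : S1)))
      = fun p => fderiv ℝ (fun p : ℂ × ℝ => φ (p.1, (p.2 : S1))) p (0, 1) :=
    funext fun p => (h.hasDerivAt_dTheta_coe p.1 p.2).deriv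
  rw [this]
  exact (h.smooth.continuous_fderiv (by simp)).clm_apply continuous_const

theorem continuous_fderiv_slice (h : IsTestFunction φ) :
    Continuous fun p : ℂ × S1 => fderiv ℝ (fun z => φ (z, p.2)) p.1 := by
  refine continuous_of_continuous_comp_coe ?_
  have : (fun p : ℂ × ℝ => fderiv ℝ (fun z => φ (z, (p.2 : S1))) p.1)
      = fun p => (fderiv ℝ (fun p : ℂ × ℝ => φ (p.1, (p.2 : S1))) p).comp
        (ContinuousLinearMap.inl ℝ ℂ ℝ) :=
    funext fun p => (h.hasFDerivAt_slice p.1 p.2).fderiv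
  rw [this]
  exact (h.smooth.continuous_fderiv (by simp)).clm_comp continuous_const

theorem continuous_dZ (h : IsTestFunction φ) : Continuous (dZ φ) := by
  have := h.continuous_fderiv_slice
  unfold dZ
  fun_prop

theorem continuous_dZbar (h : IsTestFunction φ) : Continuous (dZbar φ) := by
  have := h.continuous_fderiv_slice
  unfold dZbar
  fun_prop

end IsTestFunction

/-- The derivative `∂/∂r` in polar coordinates. -/
def dRadial (φ : ℂ × S1 → ℂ) (p : ℝ × S1 × S1) : ℂ :=
  fderiv ℝ (fun z => φ (z, p.2.2)) (polarMap p).1 (fourier 1 p.2.1)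

/-- The derivative `∂/∂α` in polar coordinates. -/
def dAngular (φ : ℂ × S1 → ℂ) (p : ℝ × S1 × S1) : ℂ :=
  fderiv ℝ (fun z => φ (z, p.2.2)) (polarMap p).1 (Complex.I * (p.1 * fourier 1 p.2.1))

theorem clm_apply_eq_re_im (L : ℂ →L[ℝ] ℂ) (w : ℂ) : L w = w.re * L 1 + w.im * L Complex.I := by
  have : w = w.re • (1 : ℂ) + w.im • Complex.I := by simp
  conv_lhs => rw [this]
  rw [map_add, map_smul, map_smul, Complex.real_smul, Complex.real_smul]

theorem I_div_mul_clm_apply (L : ℂ →L[ℝ] ℂ) {r : ℝ} (hr : (r : ℂ) ≠ 0) (e : ℂ) :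
    Complex.I / r * L (Complex.I * (r * e)) = Complex.I * L (Complex.I * e) := by
  have : Complex.I * (r * e) = r • (Complex.I * e) := by rw [Complex.real_smul]; ring
  rw [this, map_smul, Complex.real_smul]
  field_simp

theorem fourier_one_mul_fourier_neg_one (x : S1) :
    (fourier 1 x : ℂ) * fourier (-1) x = 1 := by
  rw [← fourier_add]; simp

theorem two_mul_dZbar_polarMap (φ : ℂ × S1 → ℂ) {p : ℝ × S1 × S1} (hp : 0 < p.1) :
    2 * dZbar φ (polarMap p) = fourier 1 p.2.1 *
      (dRadial φ p + Complex.I / p.1 * dAngular φ p) := by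
  have hp0 : (p.1 : ℂ) ≠ 0 := by exact_mod_cast hp.ne'
  have he := fourier_one_mul_fourier_neg_one p.2.1
  unfold dZbar dRadial dAngular
  have : (polarMap p).2 = p.2.2 := rfl
  rw [this]
  -- What remains is an identity for an arbitrary real-linear `L` and a unit complex number `e`.
  generalize fderiv ℝ (fun z => φ (z, p.2.2)) (polarMap p).1 = L
  rw [fourier_neg] at he
  generalize (fourier 1 p.2.1 : ℂ) = e at *
  rw [I_div_mul_clm_apply L hp0, clm_apply_eq_re_im L e, clm_apply_eq_re_im L (Complex.I * e)]
  have h1 : (e.re : ℂ) - Complex.I * e.im = (starRingEnd ℂ) e := by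
    apply Complex.ext <;> simp
  simp only [Complex.I_mul_re, Complex.I_mul_im]
  push_cast
  rw [mul_div_cancel₀ _ (two_ne_zero' ℂ)]
  rw [← h1] at he
  linear_combination (-(L 1) - Complex.I * L Complex.I) * he
    - (e.im * e * L Complex.I) * Complex.I_sq

theorem two_mul_dZ_polarMap (φ : ℂ × S1 → ℂ) {p : ℝ × S1 × S1} (hp : 0 < p.1) :
    2 * dZ φ (polarMap p) = fourier (-1) p.2.1 *
      (dRadial φ p - Complex.I / p.1 * dAngular φ p) := by
  have hp0 : (p.1 : ℂ) ≠ 0 := by exact_mod_cast hp.ne'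
  have he := fourier_one_mul_fourier_neg_one p.2.1
  unfold dZ dRadial dAngular
  have : (polarMap p).2 = p.2.2 := rfl
  rw [this]
  generalize fderiv ℝ (fun z => φ (z, p.2.2)) (polarMap p).1 = L
  rw [fourier_neg] at *
  generalize (fourier 1 p.2.1 : ℂ) = e at *
  rw [I_div_mul_clm_apply L hp0, clm_apply_eq_re_im L e, clm_apply_eq_re_im L (Complex.I * e)]
  have h1 : (e.re : ℂ) + Complex.I * e.im = e := by
    apply Complex.ext <;> simp
  simp only [Complex.I_mul_re, Complex.I_mul_im]
  push_cast
  rw [mul_div_cancel₀ _ (two_ne_zero' ℂ)]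
  generalize (starRingEnd ℂ) e = e' at *
  linear_combination (-(L 1) + Complex.I * L Complex.I) * he
    - e' * (L 1 - Complex.I * L Complex.I) * h1 - (e.im * e' * L Complex.I) * Complex.I_sq

namespace IsTestFunction

variable {φ : ℂ × S1 → ℂ}

theorem hasDerivAt_dRadial (h : IsTestFunction φ) (r : ℝ) (q : S1 × S1) :
    HasDerivAt (fun r : ℝ => φ (polarMap (r, q))) (dRadial φ (r, q)) r := by
  have h1 : HasDerivAt (fun r : ℝ => (r : ℂ) * fourier 1 q.1) (fourier 1 q.1) r :=
    ((hasDerivAt_id r).ofReal_comp.mul_const _).congr_deriv (by simp)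
  exact (h.differentiableAt_slice _ q.2).hasFDerivAt.comp_hasDerivAt r h1

theorem hasDerivAt_dAngular (h : IsTestFunction φ) (r : ℝ) (a : ℝ) (y : S1) :
    HasDerivAt (fun a : ℝ => φ (polarMap (r, (a : S1), y))) (dAngular φ (r, (a : S1), y)) a := by
  have h1 : HasDerivAt (fun a : ℝ => (r : ℂ) * fourier 1 (a : S1))
      (Complex.I * (r * fourier 1 (a : S1))) a := by
    simp only [fourier_coe_two_pi]
    refine ((((hasDerivAt_id a).ofReal_comp.const_mul ((1 : ℤ) : ℂ)).mul_const
      Complex.I).cexp.const_mul (r : ℂ)).congr_deriv ?_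
    simp
    ring
  exact (h.differentiableAt_slice _ y).hasFDerivAt.comp_hasDerivAt a h1

theorem hasDerivAt_dTheta_polarMap (h : IsTestFunction φ) (r : ℝ) (x : S1) (b : ℝ) :
    HasDerivAt (fun b : ℝ => φ (polarMap (r, x, (b : S1))))
      (dTheta φ (polarMap (r, x, (b : S1)))) b := by
  have h1 := h.hasDerivAt_dTheta (polarMap (r, x, (b : S1))).1 (b : S1)
  have h2 : HasDerivAt (fun s : ℝ => s - b) 1 b := (hasDerivAt_id b).sub_const b
  have h3 := HasDerivAt.scomp (g₁ := fun s : ℝ => φ ((polarMap (r, x, (b : S1))).1,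
    (b : S1) + (s : S1))) b (by rwa [sub_self]) h2
  rw [one_smul] at h3
  refine h3.congr_of_eventuallyEq (Filter.Eventually.of_forall fun s => ?_)
  simp only [Function.comp, polarMap]
  rw [← AddCircle.coe_add, add_sub_cancel]

end IsTestFunction

/-! ### Elements of the kernel have weakly radial Fourier coefficients -/

/-- The function `χ(r) e^{-ikα - imθ}`. -/
def modeFunction (χ : ℝ → ℝ) (m k : ℤ) (p : ℂ × S1) : ℂ :=
  (χ ‖p.1‖ : ℂ) * ((p.1 / ‖p.1‖) ^ (-k) * fourier (-m) p.2)

theorem fourier_one_zpow (k : ℤ) (x : S1) : (fourier 1 x : ℂ) ^ k = fourier k x := by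
  induction x using QuotientAddGroup.induction_on with
  | H a =>
    have h := fourier_coe_two_pi 1 a
    have h' := fourier_coe_two_pi k a
    rw [h, h', ← Complex.exp_int_mul]
    congr 1
    push_cast
    ring

theorem modeFunction_polarMap (χ : ℝ → ℝ) (m k : ℤ) {r : ℝ} (hr : 0 < r) (q : S1 × S1) :
    modeFunction χ m k (polarMap (r, q)) = χ r * torusChar (-m) (-k) q := by
  have hr0 : (r : ℂ) ≠ 0 := by exact_mod_cast hr.ne'
  unfold modeFunction
  rw [norm_polarMap_fst, abs_of_pos hr, polarMap, mul_div_cancel_left₀ _ hr0, fourier_one_zpow,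
    torusChar]

theorem contDiffAt_zpow_complex {E : Type*} [NormedAddCommGroup E] [NormedSpace ℝ E] {f : E → ℂ}
    {x : E} (hf : ContDiffAt ℝ ∞ f x) (hx : f x ≠ 0) (k : ℤ) :
    ContDiffAt ℝ ∞ (fun y => f y ^ k) x := by
  obtain ⟨j, rfl | rfl⟩ := k.eq_nat_or_neg
  · simp only [zpow_natCast]
    exact hf.pow j
  · simp only [zpow_neg, zpow_natCast]
    exact (hf.pow j).inv (pow_ne_zero _ hx)

/-- The phase `z/|z|` is singular only at `z = 0`, where the radial factor is locally zero. -/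
theorem isTestFunction_modeFunction {χ : ℝ → ℝ} (h1 : ContDiff ℝ ∞ χ)
    (h3 : tsupport χ ⊆ Set.Ioo 0 1) (m k : ℤ) : IsTestFunction (modeFunction χ m k) := by
  have hcl : IsClosed {p : ℂ × S1 | ‖p.1‖ ∈ tsupport χ} :=
    (isClosed_tsupport χ).preimage (continuous_fst.norm)
  have hsub : tsupport (modeFunction χ m k) ⊆ {p : ℂ × S1 | ‖p.1‖ ∈ tsupport χ} := by
    refine closure_minimal (fun p hp => ?_) hcl
    by_contra hp'
    apply hp
    have : χ ‖p.1‖ = 0 := image_eq_zero_of_notMem_tsupport hp'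
    simp [modeFunction, this]
  refine ⟨?_, ?_, fun p hp => h3 (hsub hp)⟩
  · rw [contDiff_iff_contDiffAt]
    intro p
    by_cases hp : ‖p.1‖ ∈ tsupport χ
    · have hp0 : p.1 ≠ 0 := norm_pos_iff.1 (h3 hp).1
      have hn : ContDiffAt ℝ ∞ (fun p : ℂ × ℝ => ‖p.1‖) p :=
        (contDiffAt_norm ℝ hp0).comp p contDiffAt_fst
      have hc : ∀ {u : ℂ × ℝ → ℝ}, ContDiffAt ℝ ∞ u p →
          ContDiffAt ℝ ∞ (fun p => (u p : ℂ)) p := fun hu =>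
        Complex.ofRealCLM.contDiff.contDiffAt.comp p hu
      have hn0 : (‖p.1‖ : ℂ) ≠ 0 := by exact_mod_cast (h3 hp).1.ne'
      have hd : ContDiffAt ℝ ∞ (fun p : ℂ × ℝ => p.1 / (‖p.1‖ : ℂ)) p := by
        simp only [div_eq_mul_inv]
        exact contDiffAt_fst.mul ((hc hn).inv hn0)
      have hz := contDiffAt_zpow_complex hd (div_ne_zero hp0 hn0) (-k)
      unfold modeFunction
      simp only [fourier_coe_two_pi]
      refine (hc (h1.contDiffAt.comp p hn)).mul (hz.mul ?_)
      exact ((contDiffAt_const.mul (hc contDiffAt_snd)).mul contDiffAt_const).cexp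
    · refine contDiffAt_const (c := (0 : ℂ)).congr_of_eventuallyEq ?_
      have : {p : ℂ × ℝ | ‖p.1‖ ∉ tsupport χ} ∈ nhds p :=
        ((isClosed_tsupport χ).preimage (continuous_fst.norm)).isOpen_compl.mem_nhds hp
      filter_upwards [this] with q hq
      have : χ ‖q.1‖ = 0 := image_eq_zero_of_notMem_tsupport hq
      simp [modeFunction, this]
  · refine IsCompact.of_isClosed_subset
      ((isCompact_closedBall (0 : ℂ) 1).prod (isCompact_univ (X := S1))) (isClosed_tsupport _)
      fun p hp => ⟨?_, Set.mem_univ _⟩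
    rw [mem_closedBall_zero_iff]
    exact (h3 (hsub hp)).2.le

theorem hasDerivAt_fourier_coe (k : ℤ) (a : ℝ) :
    HasDerivAt (fun a : ℝ => (fourier k (a : S1) : ℂ)) (Complex.I * k * fourier k (a : S1)) a := by
  simp only [fourier_coe_two_pi]
  refine ((((hasDerivAt_id a).ofReal_comp.const_mul (k : ℂ)).mul_const
    Complex.I).cexp).congr_deriv ?_
  simp
  ring

section

variable {χ : ℝ → ℝ} (h1 : ContDiff ℝ ∞ χ) (h3 : tsupport χ ⊆ Set.Ioo 0 1) (m k : ℤ)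
  {r : ℝ} (hr : 0 < r) (q : S1 × S1)
include h1 h3 hr

theorem dRadial_modeFunction : dRadial (modeFunction χ m k) (r, q)
    = (deriv χ r : ℝ) * torusChar (-m) (-k) q := by
  refine ((isTestFunction_modeFunction h1 h3 m k).hasDerivAt_dRadial r q).unique ?_
  refine (((h1.differentiable (by simp)) r).hasDerivAt.ofReal_comp.mul_const
    (torusChar (-m) (-k) q)).congr_of_eventuallyEq ?_
  filter_upwards [Ioi_mem_nhds hr] with s hs
  exact modeFunction_polarMap χ m k hs q

theorem dAngular_modeFunction : dAngular (modeFunction χ m k) (r, q)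
    = -(Complex.I * k) * (χ r * torusChar (-m) (-k) q) := by
  obtain ⟨x, y⟩ := q
  induction x using QuotientAddGroup.induction_on with
  | H a =>
    refine ((isTestFunction_modeFunction h1 h3 m k).hasDerivAt_dAngular r a y).unique ?_
    simp only [modeFunction_polarMap χ m k hr, torusChar]
    refine (((hasDerivAt_fourier_coe (-k) a).mul_const _).const_mul _).congr_deriv ?_
    push_cast
    ring

theorem dTheta_modeFunction : dTheta (modeFunction χ m k) (polarMap (r, q))
    = -(Complex.I * m) * (χ r * torusChar (-m) (-k) q) := by
  obtain ⟨x, y⟩ := q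
  induction y using QuotientAddGroup.induction_on with
  | H b =>
    refine ((isTestFunction_modeFunction h1 h3 m k).hasDerivAt_dTheta_polarMap r x b).unique ?_
    simp only [modeFunction_polarMap χ m k hr, torusChar]
    refine (((hasDerivAt_fourier_coe (-m) b).const_mul _).const_mul _).congr_deriv ?_
    push_cast
    ring

/-- The factor `e^{iα}` in `∂/∂z̄` shifts the angular frequency by one; this is why `f_{m,n+1}` is
coupled to `g_{m,n}`. -/
theorem dZbar_modeFunction : 2 * dZbar (modeFunction χ m k) (polarMap (r, q))
    = ((deriv χ r + k / r * χ r : ℝ) : ℂ) * torusChar (-m) (-(k - 1)) q := by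
  rw [two_mul_dZbar_polarMap _ (p := (r, q)) hr, dRadial_modeFunction h1 h3 m k hr,
    dAngular_modeFunction h1 h3 m k hr, torusChar, torusChar, show -(k - 1) = 1 + -k by ring,
    fourier_add]
  push_cast
  linear_combination (-(fourier 1 q.1 * (k / r * χ r * (fourier (-k) q.1 * fourier (-m) q.2)) : ℂ))
    * Complex.I_sq

theorem dZ_modeFunction : 2 * dZ (modeFunction χ m k) (polarMap (r, q))
    = ((deriv χ r - k / r * χ r : ℝ) : ℂ) * torusChar (-m) (-(k + 1)) q := by
  rw [two_mul_dZ_polarMap _ (p := (r, q)) hr, dRadial_modeFunction h1 h3 m k hr,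
    dAngular_modeFunction h1 h3 m k hr, torusChar, torusChar, show -(k + 1) = -1 + -k by ring,
    fourier_add]
  push_cast
  linear_combination
    (fourier (-1) q.1 * (k / r * χ r * (fourier (-k) q.1 * fourier (-m) q.2)) : ℂ) * Complex.I_sq

end

/-- The Fourier coefficients of a component of `F` on the tori of radius `r`. -/
def componentCoeff (F : H) (i : Fin 2) (m n : ℤ) (r : ℝ) : ℂ :=
  fiberCoeff (fun p => F (polarMap p) i) m n r

theorem integrableOn_mul_componentCoeff (F : H) (i : Fin 2) (m n : ℤ) :
    IntegrableOn (fun r : ℝ => (r : ℂ) * componentCoeff F i m n r) (Set.Ioc 0 1) :=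
  integrableOn_mul_fiberCoeff (integrable_component_polarMap F i) m n

theorem integrableOn_mul_mul_componentCoeff (F : H) (i : Fin 2) (m n : ℤ) {h : ℝ → ℂ}
    (hh : Continuous h) {C : ℝ} (hC : ∀ r, ‖h r‖ ≤ C) :
    IntegrableOn (fun r : ℝ => (r : ℂ) * h r * componentCoeff F i m n r) (Set.Ioc 0 1) :=
  integrableOn_mul_mul_fiberCoeff (integrable_component_polarMap F i) m n hh hC

theorem pairing_eq_setIntegral (F : H) (i : Fin 2) {φ : ℂ × S1 → ℂ} (hφ : Continuous φ) {m n : ℤ}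
    {h : ℝ → ℂ} (hh : Continuous h) {C : ℝ} (hC : ∀ r, ‖h r‖ ≤ C)
    (hφh : ∀ r, 0 < r → ∀ q, φ (polarMap (r, q)) = h r * torusChar (-m) (-n) q) :
    pairing (fun x => F x i) φ = ∫ r : ℝ in Set.Ioc 0 1, r * h r * componentCoeff F i m n r := by
  unfold componentCoeff
  rw [pairing_eq_integral_polarMeasure F i hφ,
    ← integral_mul_torusChar (integrable_component_polarMap F i) hh hC]
  refine integral_congr_ae ?_
  filter_upwards [ae_polarMeasure_pos] with p hp
  rw [← hφh p.1 hp]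

theorem pairing_const_mul (u φ : ℂ × S1 → ℂ) (c : ℂ) :
    pairing u (fun p => c * φ p) = c * pairing u φ := by
  unfold pairing
  rw [← integral_const_mul]
  congr 1
  ext p
  ring

theorem pairing_zero (i : Fin 2) (φ : ℂ × S1 → ℂ) :
    pairing (fun x => (0 : H) x i) φ = 0 := by
  unfold pairing
  refine integral_eq_zero_of_ae ?_
  filter_upwards [Lp.coeFn_zero (EuclideanSpace ℂ (Fin 2)) 2
    ((volume : Measure (ℂ × S1)).restrict puncturedSolidTorus)] with p hp
  rw [hp]
  simp

theorem mem_diracKernel_iff (F : H) : F ∈ diracKernel ↔ ∀ φ, IsTestFunction φ →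
    Complex.I * pairing (fun x => F x 0) (dTheta φ)
      - pairing (fun x => F x 1) (fun p => 2 * dZbar φ p) = 0 ∧
    pairing (fun x => F x 0) (fun p => 2 * dZ φ p)
      - Complex.I * pairing (fun x => F x 1) (dTheta φ) = 0 := by
  refine forall₂_congr fun φ _ => ?_
  rw [pairing_zero, pairing_zero, pairing_const_mul, pairing_const_mul, Complex.div_I]
  refine and_congr ?_ ?_
  · rw [← sub_eq_zero (a := _ + _)]
    ring_nf
  · rw [← sub_eq_zero (a := _ - _) (b := (0 : ℂ))]
    ring_nf

theorem exists_bound_deriv_add_div {χ : ℝ → ℝ} (h1 : ContDiff ℝ ∞ χ) (h2 : HasCompactSupport χ)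
    (h3 : tsupport χ ⊆ Set.Ioo 0 1) (c : ℝ) :
    Continuous (fun r => ((deriv χ r + c / r * χ r : ℝ) : ℂ)) ∧
      ∃ C, ∀ r, ‖((deriv χ r + c / r * χ r : ℝ) : ℂ)‖ ≤ C := by
  have h4 : Continuous fun r => c / r * χ r :=
    (contDiff_mul_of_tsupport_subset isOpen_Ioi
      (contDiffOn_const.div contDiffOn_id fun r hr => ne_of_gt hr) h1
      (h3.trans fun r hr => hr.1)).continuous
  have h5 : HasCompactSupport fun r => c / r * χ r :=
    h2.of_isClosed_subset (isClosed_tsupport _) (tsupport_mul_subset_right' _ χ)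
  have h6 := (h1.continuous_deriv (by simp)).add h4
  obtain ⟨C, hC⟩ := h6.bounded_above_of_compact_support (h2.deriv.add h5)
  refine ⟨Complex.continuous_ofReal.comp h6, C, fun r => ?_⟩
  rw [Complex.norm_real]
  exact hC r

theorem isWeakRadialSolution_componentCoeff {F : H} (hF : F ∈ diracKernel) (m n : ℤ) :
    IsWeakRadialSolution m n (componentCoeff F 0 m (n + 1)) (componentCoeff F 1 m n) := by
  rw [mem_diracKernel_iff] at hF
  have hχ : ∀ χ : ℝ → ℝ, ContDiff ℝ ∞ χ → HasCompactSupport χ →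
      Continuous (fun r => -(Complex.I * m) * (χ r : ℂ)) ∧
        ∃ C, ∀ r, ‖-(Complex.I * m) * (χ r : ℂ)‖ ≤ C := fun χ h1 h2 => by
    have hc : Continuous (fun r => -(Complex.I * m) * (χ r : ℂ)) :=
      continuous_const.mul (Complex.continuous_ofReal.comp h1.continuous)
    obtain ⟨C, hC⟩ := h1.continuous.bounded_above_of_compact_support h2
    refine ⟨hc, ‖-(Complex.I * m)‖ * C, fun r => ?_⟩
    rw [norm_mul, Complex.norm_real]
    gcongr
    exact hC r
  constructor
  · intro χ h1 h2 h3
    -- Frequency `n + 1` picks out `f_{m,n+1}` directly and, after the shift by `∂/∂z̄`, `g_{m,n}`.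
    -- The second equation uses frequency `n`, which `∂/∂z` raises.
    have hφ := isTestFunction_modeFunction h1 h3 m (n + 1)
    have h := (hF _ hφ).1
    obtain ⟨c1, C1, b1⟩ := hχ χ h1 h2
    obtain ⟨c2, C2, b2⟩ := exists_bound_deriv_add_div h1 h2 h3 ((n + 1 : ℤ) : ℝ)
    rw [pairing_eq_setIntegral F 0 hφ.continuous_dTheta (m := m) (n := n + 1) c1 b1
        (fun r hr q => by rw [dTheta_modeFunction h1 h3 m _ hr]; ring),
      pairing_eq_setIntegral F 1 (hφ.continuous_dZbar.const_mul 2) (m := m) (n := n) c2 b2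
        (fun r hr q => by rw [dZbar_modeFunction h1 h3 m _ hr, add_sub_cancel_right]),
      ← integral_const_mul, ← integral_sub
        ((integrableOn_mul_mul_componentCoeff F 0 m (n + 1) c1 b1).const_mul _)
        (integrableOn_mul_mul_componentCoeff F 1 m n c2 b2)] at h
    rw [← h]
    refine setIntegral_congr_fun measurableSet_Ioc fun r hr => ?_
    have hr0 : (r : ℂ) ≠ 0 := by exact_mod_cast hr.1.ne'
    push_cast
    field_simp
    rw [Complex.I_sq]
    ring
  · intro χ h1 h2 h3
    have hφ := isTestFunction_modeFunction h1 h3 m n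
    have h := (hF _ hφ).2
    obtain ⟨c1, C1, b1⟩ := hχ χ h1 h2
    obtain ⟨c2, C2, b2⟩ := exists_bound_deriv_add_div h1 h2 h3 (-n)
    rw [pairing_eq_setIntegral F 1 hφ.continuous_dTheta (m := m) (n := n) c1 b1
        (fun r hr q => by rw [dTheta_modeFunction h1 h3 m _ hr]; ring),
      pairing_eq_setIntegral F 0 (hφ.continuous_dZ.const_mul 2) (m := m) (n := n + 1) c2 b2
        (fun r hr q => by rw [dZ_modeFunction h1 h3 m _ hr, neg_div, neg_mul, ← sub_eq_add_neg]),
      ← integral_const_mul, ← integral_sub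
        (integrableOn_mul_mul_componentCoeff F 0 m (n + 1) c2 b2)
        ((integrableOn_mul_mul_componentCoeff F 1 m n c1 b1).const_mul _)] at h
    rw [← h]
    refine setIntegral_congr_fun measurableSet_Ioc fun r hr => ?_
    have hr0 : (r : ℂ) ≠ 0 := by exact_mod_cast hr.1.ne'
    push_cast
    field_simp
    rw [Complex.I_sq]
    ring

/-! ### Uniqueness for Fourier coefficients on the torus -/

/-- Vanishing coefficients are summable, so the Fourier series of the continuous function converges
to it pointwise, and its sum is zero. -/
theorem eq_zero_of_integral_mul_fourier_eq_zero {u : S1 → ℂ} (hu : Continuous u)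
    (h : ∀ n : ℤ, ∫ x, u x * fourier (-n) x = 0) (x : S1) : u x = 0 := by
  have h0 : ∀ n : ℤ, fourierCoeff u n = 0 := fun n => by
    rw [fourierCoeff_eq_intervalIntegral _ n 0,
      AddCircle.intervalIntegral_preimage (2 * Real.pi) 0 (fun x : S1 => fourier (-n) x • u x)]
    simp only [smul_eq_mul, mul_comm (fourier (-n) _ : ℂ)]
    rw [h n, smul_zero]
  have h1 := has_pointwise_sum_fourier_series_of_summable (f := ⟨u, hu⟩)
    (by
      have : fourierCoeff (⇑(⟨u, hu⟩ : C(S1, ℂ))) = fun _ => 0 := funext h0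
      rw [this]
      exact summable_zero) x
  have h2 : ∀ n : ℤ, fourierCoeff (⇑(⟨u, hu⟩ : C(S1, ℂ))) n • (fourier n x : ℂ) = 0 := fun n => by
    have := h0 n
    simp only [ContinuousMap.coe_mk, this, zero_smul]
  simp only [h2] at h1
  exact h1.unique hasSum_zero

theorem integrable_of_continuous_compactSpace {X : Type*} [TopologicalSpace X] [CompactSpace X]
    [MeasurableSpace X] [OpensMeasurableSpace X] {μ : Measure X} [IsFiniteMeasure μ]
    {u : X → ℂ} (hu : Continuous u) : Integrable u μ :=
  hu.integrable_of_hasCompactSupport (HasCompactSupport.of_compactSpace u)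

/-- Apply the circle case twice: first to the partial coefficients in `x`, which are continuous in
`y`, then to `u` on each slice. -/
theorem eq_zero_of_integral_mul_torusChar_eq_zero {u : S1 × S1 → ℂ} (hu : Continuous u)
    (h : ∀ m n : ℤ, ∫ q, u q * torusChar (-m) (-n) q = 0) (q : S1 × S1) : u q = 0 := by
  have hc : ∀ n : ℤ, Continuous fun y : S1 => ∫ x : S1, u (x, y) * fourier (-n) x := fun n => by
    obtain ⟨C, hC⟩ := hu.bounded_above_of_compact_support (HasCompactSupport.of_compactSpace u)
    refine continuous_of_dominated (bound := fun _ => C)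
      (fun y => Continuous.aestronglyMeasurable (by fun_prop))
      (fun y => Filter.Eventually.of_forall fun x => ?_) (integrable_const _)
      (Filter.Eventually.of_forall fun x => by fun_prop)
    rw [norm_mul, norm_fourier, mul_one]
    exact hC _
  refine eq_zero_of_integral_mul_fourier_eq_zero (u := fun x => u (x, q.2)) (by fun_prop)
    (fun n => ?_) q.1
  refine eq_zero_of_integral_mul_fourier_eq_zero (hc n) (fun m => ?_) q.2
  rw [← h m n, Measure.volume_eq_prod, integral_prod_symm]
  · refine integral_congr_ae (Filter.Eventually.of_forall fun y => ?_)
    simp only [torusChar]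
    rw [← integral_mul_const]
    refine integral_congr_ae (Filter.Eventually.of_forall fun x => ?_)
    simp only
    ring
  · exact integrable_of_continuous_compactSpace (hu.mul (continuous_torusChar _ _))

/-! ### Averaging over rotations -/

theorem continuous_fiberCoeff {ψ : ℝ × S1 × S1 → ℂ} (hψ : Continuous ψ) {C : ℝ}
    (hC : ∀ p, ‖ψ p‖ ≤ C) (m n : ℤ) : Continuous (fiberCoeff ψ m n) := by
  have := continuous_torusChar (-m) (-n)
  refine continuous_of_dominated (bound := fun _ => C)
    (fun y => Continuous.aestronglyMeasurable (by fun_prop))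
    (fun y => Filter.Eventually.of_forall fun x => ?_) (integrable_const _)
    (Filter.Eventually.of_forall fun x => by fun_prop)
  rw [norm_mul, norm_torusChar, mul_one]
  exact hC _

theorem norm_fiberCoeff_le {ψ : ℝ × S1 × S1 → ℂ} {C : ℝ} (hC : ∀ p, ‖ψ p‖ ≤ C) (m n : ℤ) (r : ℝ) :
    ‖fiberCoeff ψ m n r‖ ≤ C * (volume : Measure (S1 × S1)).real Set.univ := by
  refine norm_integral_le_of_norm_le_const (Filter.Eventually.of_forall fun q => ?_)
  rw [norm_mul, norm_torusChar, mul_one]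
  exact hC _

instance isAddLeftInvariant_volume_torus : (volume : Measure (S1 × S1)).IsAddLeftInvariant :=
  Measure.prod.instIsAddLeftInvariant

/-- The pairing of `U` with the rotations of `ψ`. -/
def rotationPairing (U ψ : ℝ × S1 × S1 → ℂ) (q : S1 × S1) : ℂ :=
  ∫ p, U p * ψ (p.1, p.2 + q) ∂polarMeasure

section

variable {U ψ : ℝ × S1 × S1 → ℂ} (hU : Integrable U polarMeasure) (hψ : Continuous ψ) {C : ℝ}
  (hC : ∀ p, ‖ψ p‖ ≤ C)
include hU hψ hC

theorem continuous_rotationPairing : Continuous (rotationPairing U ψ) := by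
  refine continuous_of_dominated (bound := fun p => ‖U p‖ * C)
    (fun q => hU.1.mul (Continuous.aestronglyMeasurable (by fun_prop)))
    (fun q => Filter.Eventually.of_forall fun p => ?_) (hU.norm.mul_const C)
    (Filter.Eventually.of_forall fun p => by fun_prop)
  rw [norm_mul]
  gcongr
  exact hC _

/-- Fubini and translation invariance on the torus. The pairing is bilinear, without conjugation, so
opposite frequencies meet. -/
theorem integral_rotationPairing_mul_torusChar (m n : ℤ) :
    ∫ q, rotationPairing U ψ q * torusChar (-m) (-n) q
      = ∫ r : ℝ in Set.Ioc 0 1, r * fiberCoeff ψ m n r * fiberCoeff U (-m) (-n) r := by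
  have hint : Integrable (Function.uncurry fun (q : S1 × S1) (p : ℝ × S1 × S1) =>
      U p * (ψ (p.1, p.2 + q) * torusChar (-m) (-n) q)) (volume.prod polarMeasure) := by
    have := continuous_torusChar (-m) (-n)
    have : OpensMeasurableSpace (ℝ × S1 × S1) := inferInstance
    have : SecondCountableTopology (S1 × S1) := inferInstance
    have : OpensMeasurableSpace ((S1 × S1) × ℝ × S1 × S1) := Prod.opensMeasurableSpace
    refine (hU.comp_snd volume).mul_bdd (c := C) (Continuous.aestronglyMeasurable (by fun_prop))
      (Filter.Eventually.of_forall fun z => ?_)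
    rw [norm_mul, norm_torusChar, mul_one]
    exact hC _
  have h1 := integral_mul_torusChar hU (continuous_fiberCoeff hψ hC m n)
    (norm_fiberCoeff_le hC m n) (-m) (-n)
  rw [neg_neg, neg_neg] at h1
  rw [← h1]
  have h2 : ∀ q, rotationPairing U ψ q * torusChar (-m) (-n) q
      = ∫ p, U p * (ψ (p.1, p.2 + q) * torusChar (-m) (-n) q) ∂polarMeasure := fun q => by
    rw [rotationPairing, ← integral_mul_const]
    simp only [mul_assoc]
  simp only [h2]
  rw [integral_integral_swap hint]
  refine integral_congr_ae (Filter.Eventually.of_forall fun p => ?_)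
  simp only
  rw [integral_const_mul]
  congr 1
  unfold fiberCoeff
  -- The angle of `ψ` is translated by `p.2`, which turns the character in `q` into a product of
  -- characters.
  rw [← integral_mul_const, ← integral_add_left_eq_self (μ := (volume : Measure (S1 × S1)))
    (fun q => ψ (p.1, q) * torusChar (-m) (-n) q * torusChar m n p.2) p.2]
  refine integral_congr_ae (Filter.Eventually.of_forall fun q => ?_)
  simp only
  rw [torusChar_add]
  linear_combination (-(ψ (p.1, p.2 + q) * torusChar (-m) (-n) q)) *
    torusChar_neg_mul_self m n p.2

end

theorem rotationPairing_zero (U ψ : ℝ × S1 × S1 → ℂ) :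
    rotationPairing U ψ 0 = ∫ p, U p * ψ p ∂polarMeasure := by
  simp [rotationPairing]

/-- Both pairings are rotated simultaneously. Their sum is a continuous function on the torus with
vanishing Fourier coefficients, and its value at the identity is the claim. -/
theorem integral_add_integral_eq_zero_of_fiberCoeff {U₁ U₂ ψ₁ ψ₂ : ℝ × S1 × S1 → ℂ}
    (hU₁ : Integrable U₁ polarMeasure) (hU₂ : Integrable U₂ polarMeasure) (hψ₁ : Continuous ψ₁)
    (hψ₂ : Continuous ψ₂) {C₁ C₂ : ℝ} (hC₁ : ∀ p, ‖ψ₁ p‖ ≤ C₁) (hC₂ : ∀ p, ‖ψ₂ p‖ ≤ C₂)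
    (h : ∀ m n : ℤ, ∫ r : ℝ in Set.Ioc 0 1, (r * fiberCoeff ψ₁ m n r * fiberCoeff U₁ (-m) (-n) r
      + r * fiberCoeff ψ₂ m n r * fiberCoeff U₂ (-m) (-n) r) = 0) :
    (∫ p, U₁ p * ψ₁ p ∂polarMeasure) + ∫ p, U₂ p * ψ₂ p ∂polarMeasure = 0 := by
  rw [← rotationPairing_zero, ← rotationPairing_zero]
  have c₁ := continuous_rotationPairing hU₁ hψ₁ hC₁
  have c₂ := continuous_rotationPairing hU₂ hψ₂ hC₂
  refine eq_zero_of_integral_mul_torusChar_eq_zero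
    (u := fun q => rotationPairing U₁ ψ₁ q + rotationPairing U₂ ψ₂ q) (c₁.add c₂)
    (fun m n => ?_) 0
  have i₁ : Integrable fun q => rotationPairing U₁ ψ₁ q * torusChar (-m) (-n) q :=
    integrable_of_continuous_compactSpace (c₁.mul (continuous_torusChar _ _))
  have i₂ : Integrable fun q => rotationPairing U₂ ψ₂ q * torusChar (-m) (-n) q :=
    integrable_of_continuous_compactSpace (c₂.mul (continuous_torusChar _ _))
  simp only [add_mul]
  rw [integral_add i₁ i₂,
    integral_rotationPairing_mul_torusChar hU₁ hψ₁ hC₁,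
    integral_rotationPairing_mul_torusChar hU₂ hψ₂ hC₂, ← integral_add, h]
  · exact integrableOn_mul_mul_fiberCoeff hU₁ _ _ (continuous_fiberCoeff hψ₁ hC₁ m n)
      (norm_fiberCoeff_le hC₁ m n)
  · exact integrableOn_mul_mul_fiberCoeff hU₂ _ _ (continuous_fiberCoeff hψ₂ hC₂ m n)
      (norm_fiberCoeff_le hC₂ m n)

/-! ### Fourier coefficients of derivatives of test functions -/

/-- Integration by parts over one period; the boundary terms agree by periodicity. -/
theorem integral_deriv_mul_fourier {u u' : S1 → ℂ} (hu' : Continuous u')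
    (hd : ∀ a : ℝ, HasDerivAt (fun a : ℝ => u (a : S1)) (u' (a : S1)) a) (n : ℤ) :
    ∫ x, u' x * fourier (-n) x = Complex.I * n * ∫ x, u x * fourier (-n) x := by
  have hcoe : Continuous fun a : ℝ => (a : S1) := AddCircle.continuous_mk' _
  have hf : Continuous fun a : ℝ => (fourier (-n) (a : S1) : ℂ) :=
    (fourier (-n)).continuous.comp hcoe
  have hu : Continuous fun a : ℝ => u (a : S1) :=
    continuous_iff_continuousAt.2 fun a => (hd a).continuousAt
  have c1 : Continuous fun a : ℝ => u' (a : S1) * (fourier (-n) (a : S1) : ℂ) :=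
    (hu'.comp hcoe).mul hf
  have c2 : Continuous fun a : ℝ => u (a : S1)
      * (Complex.I * ((-n : ℤ) : ℂ) * (fourier (-n) (a : S1) : ℂ)) := hu.mul ((continuous_const (y := Complex.I * ((-n : ℤ) : ℂ))).mul hf)
  have h0 := intervalIntegral.integral_eq_sub_of_hasDerivAt (a := 0) (b := 2 * Real.pi)
    (fun a _ => (hd a).mul (hasDerivAt_fourier_coe (-n) a)) ((c1.add c2).intervalIntegrable _ _)
  have h1 : ((2 * Real.pi : ℝ) : S1) = ((0 : ℝ) : S1) := by
    rw [AddCircle.coe_period, AddCircle.coe_zero]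
  simp only [Pi.mul_apply] at h0
  rw [h1, sub_self, intervalIntegral.integral_add (c1.intervalIntegrable _ _)
    (c2.intervalIntegrable _ _)] at h0
  rw [← AddCircle.intervalIntegral_preimage (2 * Real.pi) 0,
    ← AddCircle.intervalIntegral_preimage (2 * Real.pi) 0, zero_add,
    ← intervalIntegral.integral_const_mul, ← sub_eq_zero, ← h0, sub_eq_add_neg,
    ← intervalIntegral.integral_neg]
  congr 2
  ext a
  push_cast
  ring

namespace IsTestFunction

variable {φ : ℂ × S1 → ℂ}

theorem fderiv_slice_eq_zero {p : ℂ × S1} (hp : p ∉ tsupport φ) :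
    fderiv ℝ (fun z => φ (z, p.2)) p.1 = 0 := by
  have h1 : (fun z => φ (z, p.2)) =ᶠ[nhds p.1] fun _ => 0 := by
    have hc : Filter.Tendsto (fun z : ℂ => (z, p.2)) (nhds p.1) (nhds p) :=
      (Continuous.prodMk continuous_id continuous_const).tendsto p.1
    filter_upwards [hc ((isClosed_tsupport φ).isOpen_compl.mem_nhds hp)] with z hz
    exact image_eq_zero_of_notMem_tsupport hz
  rw [h1.fderiv_eq]
  simp

theorem dTheta_eq_zero {p : ℂ × S1} (hp : p ∉ tsupport φ) : dTheta φ p = 0 := by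
  have h1 : (fun t : ℝ => φ (p.1, p.2 + (t : S1))) =ᶠ[nhds 0] fun _ => 0 := by
    have hcoe : Continuous fun a : ℝ => (a : S1) := AddCircle.continuous_mk' _
    have hc : Filter.Tendsto (fun t : ℝ => (p.1, p.2 + (t : S1))) (nhds 0) (nhds p) := by
      have := (Continuous.prodMk (continuous_const (y := p.1))
        ((continuous_const (y := p.2)).add hcoe)).tendsto 0
      simpa using this
    filter_upwards [hc ((isClosed_tsupport φ).isOpen_compl.mem_nhds hp)] with t ht
    exact image_eq_zero_of_notMem_tsupport ht
  rw [dTheta, h1.deriv_eq]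
  simp

theorem exists_bound_fderiv_slice (h : IsTestFunction φ) :
    ∃ C, ∀ p : ℂ × S1, ‖fderiv ℝ (fun z => φ (z, p.2)) p.1‖ ≤ C :=
  h.continuous_fderiv_slice.bounded_above_of_compact_support
    (HasCompactSupport.intro h.compactSupport fun _ hp => fderiv_slice_eq_zero hp)

theorem exists_bound_dTheta (h : IsTestFunction φ) : ∃ C, ∀ p, ‖dTheta φ p‖ ≤ C :=
  h.continuous_dTheta.bounded_above_of_compact_support
    (HasCompactSupport.intro h.compactSupport fun _ hp => dTheta_eq_zero hp)

theorem exists_bound_dZ (h : IsTestFunction φ) : ∃ C, ∀ p, ‖dZ φ p‖ ≤ C :=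
  h.continuous_dZ.bounded_above_of_compact_support
    (HasCompactSupport.intro h.compactSupport fun p hp => by
      simp [dZ, fderiv_slice_eq_zero hp])

theorem exists_bound_dZbar (h : IsTestFunction φ) : ∃ C, ∀ p, ‖dZbar φ p‖ ≤ C :=
  h.continuous_dZbar.bounded_above_of_compact_support
    (HasCompactSupport.intro h.compactSupport fun p hp => by
      simp [dZbar, fderiv_slice_eq_zero hp])

theorem exists_radius (h : IsTestFunction φ) : ∃ ε, 0 < ε ∧ ε < 1 ∧ ∀ p : ℂ × S1,
    (‖p.1‖ ≤ ε ∨ ‖p.1‖ = 1) → φ p = 0 := by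
  obtain ⟨a, b, h1, h2, h3, h4⟩ := exists_Icc_of_isCompact_subset_Ioo (zero_lt_one' ℝ)
    (h.compactSupport.isCompact.image (f := fun p : ℂ × S1 => ‖p.1‖) continuous_fst.norm)
    (by rintro _ ⟨p, hp, rfl⟩; exact h.support_subset hp)
  -- The radii of the support lie in `[a, b]` with `0 < a` and `b < 1`; halving `a` makes the inner
  -- inequality strict.
  refine ⟨a / 2, by linarith, by linarith, fun p hp => ?_⟩
  by_contra h0
  have h5 := h4 ⟨p, subset_tsupport φ h0, rfl⟩
  have h6 : a ≤ ‖p.1‖ := h5.1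
  have h7 : ‖p.1‖ ≤ b := h5.2
  rcases hp with hp | hp <;> linarith

theorem continuous_dRadial (h : IsTestFunction φ) : Continuous (dRadial φ) := by
  have h1 : Continuous fun p : ℝ × S1 × S1 => fderiv ℝ (fun z => φ (z, p.2.2)) (polarMap p).1 :=
    h.continuous_fderiv_slice.comp continuous_polarMap
  exact h1.clm_apply (by fun_prop)

theorem continuous_dAngular (h : IsTestFunction φ) : Continuous (dAngular φ) := by
  have h1 : Continuous fun p : ℝ × S1 × S1 => fderiv ℝ (fun z => φ (z, p.2.2)) (polarMap p).1 :=
    h.continuous_fderiv_slice.comp continuous_polarMap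
  exact h1.clm_apply (by fun_prop)

theorem exists_bound_dRadial (h : IsTestFunction φ) : ∃ C, ∀ p, ‖dRadial φ p‖ ≤ C := by
  obtain ⟨C, hC⟩ := h.exists_bound_fderiv_slice
  refine ⟨C, fun p => ?_⟩
  have h1 := (fderiv ℝ (fun z => φ (z, p.2.2)) (polarMap p).1).le_opNorm (fourier 1 p.2.1)
  rw [norm_fourier, mul_one] at h1
  exact h1.trans (hC (polarMap p))

/-- The Fourier coefficients of a test function on the tori of radius `r`. -/
def coeff (φ : ℂ × S1 → ℂ) (m n : ℤ) (r : ℝ) : ℂ := fiberCoeff (fun p => φ (polarMap p)) m n r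

theorem hasDerivAt_coeff (h : IsTestFunction φ) (m n : ℤ) (r : ℝ) :
    HasDerivAt (coeff φ m n) (fiberCoeff (dRadial φ) m n r) r := by
  obtain ⟨C, hC⟩ := h.exists_bound_dRadial
  have c1 := h.continuous
  have c2 := continuous_polarMap
  have c3 := continuous_torusChar (-m) (-n)
  have c4 := h.continuous_dRadial
  refine (hasDerivAt_integral_of_dominated_loc_of_deriv_le (s := Set.univ) (bound := fun _ => C)
    Filter.univ_mem
    (F := fun (r : ℝ) (q : S1 × S1) => φ (polarMap (r, q)) * torusChar (-m) (-n) q)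
    (F' := fun (r : ℝ) (q : S1 × S1) => dRadial φ (r, q) * torusChar (-m) (-n) q)
    (Filter.Eventually.of_forall fun s => Continuous.aestronglyMeasurable (by fun_prop))
    (integrable_of_continuous_compactSpace (by fun_prop))
    (Continuous.aestronglyMeasurable (by fun_prop))
    (Filter.Eventually.of_forall fun q s _ => ?_) (integrable_const _)
    (Filter.Eventually.of_forall fun q s _ => (h.hasDerivAt_dRadial s q).mul_const _)).2
  rw [norm_mul, norm_torusChar, mul_one]
  exact hC _

theorem continuous_fiberCoeff_dRadial (h : IsTestFunction φ) (m n : ℤ) :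
    Continuous (fiberCoeff (dRadial φ) m n) := by
  obtain ⟨C, hC⟩ := h.exists_bound_dRadial
  exact continuous_fiberCoeff h.continuous_dRadial hC m n

theorem exists_coeff_eq_zero (h : IsTestFunction φ) : ∃ ε, 0 < ε ∧ ε < 1 ∧ ∀ m n : ℤ,
    (∀ r, 0 < r → r ≤ ε → coeff φ m n r = 0) ∧ coeff φ m n 1 = 0 := by
  obtain ⟨ε, h1, h2, h3⟩ := h.exists_radius
  refine ⟨ε, h1, h2, fun m n => ⟨fun r hr hr' => ?_, ?_⟩⟩
  · refine integral_eq_zero_of_ae (Filter.Eventually.of_forall fun q => ?_)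
    simp only
    rw [h3 _ (Or.inl (by rwa [norm_polarMap_fst, abs_of_pos hr]))]
    simp
  · refine integral_eq_zero_of_ae (Filter.Eventually.of_forall fun q => ?_)
    simp only
    rw [h3 _ (Or.inr (by rw [norm_polarMap_fst, abs_one]))]
    simp

theorem fiberCoeff_dTheta (h : IsTestFunction φ) (m n : ℤ) (r : ℝ) :
    fiberCoeff (fun p => dTheta φ (polarMap p)) m n r = Complex.I * m * coeff φ m n r := by
  have c1 := h.continuous
  have c2 := continuous_polarMap
  have c3 := continuous_torusChar (-m) (-n)
  have c4 := h.continuous_dTheta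
  unfold coeff fiberCoeff
  rw [Measure.volume_eq_prod, integral_prod _ (integrable_of_continuous_compactSpace (by fun_prop)),
    integral_prod _ (integrable_of_continuous_compactSpace (by fun_prop)), ← integral_const_mul]
  refine integral_congr_ae (Filter.Eventually.of_forall fun x => ?_)
  have h1 := integral_deriv_mul_fourier (u := fun y => φ (polarMap (r, x, y)))
    (u' := fun y => dTheta φ (polarMap (r, x, y))) (by fun_prop)
    (fun b => h.hasDerivAt_dTheta_polarMap r x b) m
  simp only [torusChar]
  calc ∫ y, dTheta φ (polarMap (r, x, y)) * (fourier (-n) x * fourier (-m) y)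
      = fourier (-n) x * ∫ y, dTheta φ (polarMap (r, x, y)) * fourier (-m) y := by
        rw [← integral_const_mul]
        refine integral_congr_ae (Filter.Eventually.of_forall fun y => ?_)
        simp only
        ring
    _ = Complex.I * m * (fourier (-n) x * ∫ y, φ (polarMap (r, x, y)) * fourier (-m) y) := by
        rw [h1]; ring
    _ = _ := by
        rw [← integral_const_mul (fourier (-n) x : ℂ)]
        congr 1
        refine integral_congr_ae (Filter.Eventually.of_forall fun y => ?_)
        simp only
        ring

theorem fiberCoeff_dAngular (h : IsTestFunction φ) (m n : ℤ) (r : ℝ) :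
    fiberCoeff (dAngular φ) m n r = Complex.I * n * coeff φ m n r := by
  have c1 := h.continuous
  have c2 := continuous_polarMap
  have c3 := continuous_torusChar (-m) (-n)
  have c4 := h.continuous_dAngular
  unfold coeff fiberCoeff
  rw [Measure.volume_eq_prod,
    integral_prod_symm _ (integrable_of_continuous_compactSpace (by fun_prop)),
    integral_prod_symm _ (integrable_of_continuous_compactSpace (by fun_prop)),
    ← integral_const_mul]
  refine integral_congr_ae (Filter.Eventually.of_forall fun y => ?_)
  have h1 := integral_deriv_mul_fourier (u := fun x => φ (polarMap (r, x, y)))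
    (u' := fun x => dAngular φ (r, x, y)) (by fun_prop)
    (fun a => h.hasDerivAt_dAngular r a y) n
  simp only [torusChar]
  calc ∫ x, dAngular φ (r, x, y) * (fourier (-n) x * fourier (-m) y)
      = (∫ x, dAngular φ (r, x, y) * fourier (-n) x) * fourier (-m) y := by
        rw [← integral_mul_const]
        refine integral_congr_ae (Filter.Eventually.of_forall fun x => ?_)
        simp only
        ring
    _ = Complex.I * n * ((∫ x, φ (polarMap (r, x, y)) * fourier (-n) x) * fourier (-m) y) := by
        rw [h1]; ring
    _ = _ := by
        rw [← integral_mul_const]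
        congr 1
        refine integral_congr_ae (Filter.Eventually.of_forall fun x => ?_)
        simp only
        ring

theorem fiberCoeff_dRadial_add (h : IsTestFunction φ) (m n : ℤ) (r : ℝ) (c : ℂ) :
    fiberCoeff (fun p => dRadial φ p + c * dAngular φ p) m n r
      = fiberCoeff (dRadial φ) m n r + c * (Complex.I * n * coeff φ m n r) := by
  have c3 := continuous_torusChar (-m) (-n)
  have c4 := h.continuous_dAngular
  have c5 := h.continuous_dRadial
  rw [← h.fiberCoeff_dAngular]
  unfold fiberCoeff
  have i1 : Integrable fun q : S1 × S1 => dRadial φ (r, q) * torusChar (-m) (-n) q :=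
    integrable_of_continuous_compactSpace (by fun_prop)
  have i2 : Integrable fun q : S1 × S1 => c * (dAngular φ (r, q) * torusChar (-m) (-n) q) :=
    integrable_of_continuous_compactSpace (by fun_prop)
  rw [← integral_const_mul, ← integral_add i1 i2]
  refine integral_congr_ae (Filter.Eventually.of_forall fun q => ?_)
  simp only
  ring

theorem fiberCoeff_dZbar (h : IsTestFunction φ) (m n : ℤ) {r : ℝ} (hr : 0 < r) :
    fiberCoeff (fun p => fourier (-1) p.2.1 * (2 * dZbar φ (polarMap p))) m n r
      = fiberCoeff (dRadial φ) m n r - n / r * coeff φ m n r := by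
  have h1 := h.fiberCoeff_dRadial_add m n r (Complex.I / r)
  have h2 : fiberCoeff (fun p => fourier (-1) p.2.1 * (2 * dZbar φ (polarMap p))) m n r
      = fiberCoeff (fun p => dRadial φ p + Complex.I / r * dAngular φ p) m n r := by
    refine integral_congr_ae (Filter.Eventually.of_forall fun q => ?_)
    simp only
    rw [two_mul_dZbar_polarMap φ (p := (r, q)) hr, ← mul_assoc, mul_comm (fourier (-1) q.1 : ℂ),
      fourier_one_mul_fourier_neg_one, one_mul]
  rw [h2, h1]
  linear_combination (n / r * coeff φ m n r) * Complex.I_sq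

theorem fiberCoeff_dZ (h : IsTestFunction φ) (m n : ℤ) {r : ℝ} (hr : 0 < r) :
    fiberCoeff (fun p => fourier 1 p.2.1 * (2 * dZ φ (polarMap p))) m n r
      = fiberCoeff (dRadial φ) m n r + n / r * coeff φ m n r := by
  have h1 := h.fiberCoeff_dRadial_add m n r (-(Complex.I / r))
  have h2 : fiberCoeff (fun p => fourier 1 p.2.1 * (2 * dZ φ (polarMap p))) m n r
      = fiberCoeff (fun p => dRadial φ p + -(Complex.I / r) * dAngular φ p) m n r := by
    refine integral_congr_ae (Filter.Eventually.of_forall fun q => ?_)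
    simp only
    rw [two_mul_dZ_polarMap φ (p := (r, q)) hr, ← mul_assoc,
      fourier_one_mul_fourier_neg_one, one_mul, neg_mul, ← sub_eq_add_neg]
  rw [h2, h1]
  linear_combination (-(n / r * coeff φ m n r)) * Complex.I_sq

end IsTestFunction

/-! ### The kernel in terms of Fourier coefficients -/

theorem integrable_component_mul_fourier (F : H) (i : Fin 2) (c : ℂ) (k : ℤ) :
    Integrable (fun p => c * (F (polarMap p) i * fourier k p.2.1)) polarMeasure := by
  refine ((integrable_component_polarMap F i).mul_bdd (c := 1)
    (Continuous.aestronglyMeasurable (by fun_prop))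
    (Filter.Eventually.of_forall fun p => ?_)).const_mul c
  rw [norm_fourier]

theorem fiberCoeff_component_mul_fourier (F : H) (i : Fin 2) (c : ℂ) (k m n : ℤ) (r : ℝ) :
    fiberCoeff (fun p => c * (F (polarMap p) i * fourier k p.2.1)) m n r
      = c * componentCoeff F i m (n - k) r := by
  rw [fiberCoeff_const_mul, fiberCoeff_mul_fourier, componentCoeff]

/-- Inserting `e^{ikα} e^{-ikα} = 1` moves the frequency shift of `∂/∂z` or `∂/∂z̄` onto `F`. Both
terms of an equation then involve the same mode of `φ`, as the simultaneous rotation argument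
requires. -/
theorem pairing_eq_integral_mul_fourier (F : H) (i : Fin 2) {φ : ℂ × S1 → ℂ} (hφ : Continuous φ)
    (c : ℂ) (k : ℤ) : c * pairing (fun x => F x i) φ
      = ∫ p, c * (F (polarMap p) i * fourier k p.2.1) * (fourier (-k) p.2.1 * φ (polarMap p))
        ∂polarMeasure := by
  rw [pairing_eq_integral_polarMeasure F i hφ, ← integral_const_mul]
  refine integral_congr_ae (Filter.Eventually.of_forall fun p => ?_)
  have h : (fourier k p.2.1 : ℂ) * fourier (-k) p.2.1 = 1 := by
    rw [← fourier_add]; simp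
  simp only
  linear_combination (-(c * F (polarMap p) i * φ (polarMap p))) * h

theorem mem_diracKernel_of_isRadialSolution {F : H}
    (h : ∀ m n : ℤ, ∃ f g : ℝ → ℂ, IsRadialSolution m n f g ∧
      ∀ᵐ r : ℝ ∂(volume.restrict (Set.Ioc 0 1)),
        componentCoeff F 0 m (n + 1) r = f r ∧ componentCoeff F 1 m n r = g r) :
    F ∈ diracKernel := by
  rw [mem_diracKernel_iff]
  intro φ hφ
  have hP := continuous_polarMap
  have hT := hφ.continuous_dTheta
  obtain ⟨C, hC⟩ := hφ.exists_bound_dTheta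
  obtain ⟨ε, hε, hε1, hχ⟩ := hφ.exists_coeff_eq_zero
  have hfou : ∀ (k : ℤ) {ψ : ℂ × S1 → ℂ} {C : ℝ}, (∀ p, ‖ψ p‖ ≤ C) → ∀ p : ℝ × S1 × S1,
      ‖(fourier k p.2.1 : ℂ) * (2 * ψ (polarMap p))‖ ≤ 2 * C := fun k ψ C h p => by
    rw [norm_mul, norm_fourier, one_mul, norm_mul, Complex.norm_ofNat]
    gcongr
    exact h _
  have hTb : ∀ p : ℝ × S1 × S1,
      ‖(fourier (-0) p.2.1 : ℂ) * dTheta φ (polarMap p)‖ ≤ C := fun p => by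
    rw [norm_mul, norm_fourier, one_mul]
    exact hC _
  have hTf : ∀ m n r, fiberCoeff (fun p => (fourier (-0) p.2.1 : ℂ) * dTheta φ (polarMap p)) m n r
      = Complex.I * m * IsTestFunction.coeff φ m n r := fun m n r => by
    rw [← hφ.fiberCoeff_dTheta]
    simp
  constructor
  · obtain ⟨C', hC'⟩ := hφ.exists_bound_dZbar
    have hZ := hφ.continuous_dZbar
    rw [sub_eq_add_neg, ← neg_one_mul (pairing _ _),
      pairing_eq_integral_mul_fourier F 0 hT Complex.I 0,
      pairing_eq_integral_mul_fourier F 1 (hZ.const_mul 2) (-1) 1]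
    refine integral_add_integral_eq_zero_of_fiberCoeff (integrable_component_mul_fourier F 0 _ 0)
      (integrable_component_mul_fourier F 1 _ 1) (by fun_prop) (by fun_prop) hTb (hfou _ hC')
      fun m n => ?_
    -- Mode `(m, n)` of `φ` meets `f` at frequency `-n` and, because of the inserted `e^{iα}`, `g`
    -- at frequency `-n - 1`.
    obtain ⟨f, g, hfg, hae⟩ := h (-m) (-n - 1)
    rw [← hfg.integral_fst hε hε1 (fun r _ => hφ.hasDerivAt_coeff m n r)
      (hφ.continuous_fiberCoeff_dRadial m n).continuousOn (hχ m n).1 (hχ m n).2]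
    refine integral_congr_ae ?_
    filter_upwards [hae, ae_restrict_mem measurableSet_Ioc] with r hr hr'
    have hr0 : (r : ℂ) ≠ 0 := by exact_mod_cast hr'.1.ne'
    rw [sub_add_cancel] at hr
    rw [hTf, hφ.fiberCoeff_dZbar m n hr'.1, fiberCoeff_component_mul_fourier,
      fiberCoeff_component_mul_fourier, sub_zero, hr.1, hr.2]
    push_cast
    field_simp
    rw [Complex.I_sq]
    ring
  · obtain ⟨C', hC'⟩ := hφ.exists_bound_dZ
    have hZ := hφ.continuous_dZ
    rw [sub_eq_add_neg, ← one_mul (pairing _ (fun p => 2 * dZ φ p)), ← neg_mul,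
      pairing_eq_integral_mul_fourier F 1 hT (-Complex.I) 0,
      pairing_eq_integral_mul_fourier F 0 (hZ.const_mul 2) 1 (-1), neg_neg]
    refine integral_add_integral_eq_zero_of_fiberCoeff (integrable_component_mul_fourier F 0 _ _)
      (integrable_component_mul_fourier F 1 _ _) (by fun_prop) (by fun_prop) (hfou _ hC') hTb
      fun m n => ?_
    -- Now the inserted phase acts on `f`, so the pair met is `f` at `-n + 1` and `g` at `-n`.
    obtain ⟨f, g, hfg, hae⟩ := h (-m) (-n)
    rw [← hfg.integral_snd hε hε1 (fun r _ => hφ.hasDerivAt_coeff m n r)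
      (hφ.continuous_fiberCoeff_dRadial m n).continuousOn (hχ m n).1 (hχ m n).2]
    refine integral_congr_ae ?_
    filter_upwards [hae, ae_restrict_mem measurableSet_Ioc] with r hr hr'
    have hr0 : (r : ℂ) ≠ 0 := by exact_mod_cast hr'.1.ne'
    rw [hTf, hφ.fiberCoeff_dZ m n hr'.1, fiberCoeff_component_mul_fourier,
      fiberCoeff_component_mul_fourier, sub_zero, sub_neg_eq_add, hr.1, hr.2]
    push_cast
    field_simp
    rw [Complex.I_sq]
    ring

theorem IsRadialSolution.const_mul {m n : ℤ} {f g : ℝ → ℂ} (h : IsRadialSolution m n f g) (c : ℂ) :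
    IsRadialSolution m n (fun r => c * f r) (fun r => c * g r) :=
  ⟨fun r hr => ((h.fst r hr).const_mul c).congr_deriv (by ring),
    fun r hr => ((h.snd r hr).const_mul c).congr_deriv (by ring)⟩

theorem ae_torusFourierCoeff_eq_componentCoeff (F : H) (i : Fin 2) (m n : ℤ) :
    ∀ᵐ r ∂(volume.restrict (Set.Ioc (0 : ℝ) 1)), torusFourierCoeff (fun x => F x i) m n r
      = 1 / (2 * (Real.pi : ℂ)) ^ 2 * componentCoeff F i m n r :=
  ae_torusFourierCoeff_eq (integrable_component_polarMap F i) m n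

end SolidTorus

end

/-! ### The kernel of `D` -/

theorem mainTheorem7 (F : SolidTorus.H) :
    F ∈ SolidTorus.diracKernel ↔
      ∃ A B : ℤ → ℤ → ℂ,
        (∀ m : ℤ, m ≠ 0 → ∀ n : ℤ, ∀ᵐ r : ℝ ∂(MeasureTheory.volume.restrict (Set.Ioc 0 1)),
          SolidTorus.torusFourierCoeff (fun x => F x 0) m (n + 1) r =
              ((m : ℂ) / ((|(m : ℝ)| : ℝ) : ℂ)) *
                (-A m n * (SolidTorus.besselI (n + 1) (|(m : ℝ)| * r) : ℂ)
                  + B m n * (SolidTorus.besselK (n + 1) (|(m : ℝ)| * r) : ℂ)) ∧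
          SolidTorus.torusFourierCoeff (fun x => F x 1) m n r =
              A m n * (SolidTorus.besselI n (|(m : ℝ)| * r) : ℂ)
                + B m n * (SolidTorus.besselK n (|(m : ℝ)| * r) : ℂ)) ∧
        (∀ n : ℤ, ∀ᵐ r : ℝ ∂(MeasureTheory.volume.restrict (Set.Ioc 0 1)),
          SolidTorus.torusFourierCoeff (fun x => F x 0) 0 n r = A 0 n * (r : ℂ) ^ (-n) ∧
          SolidTorus.torusFourierCoeff (fun x => F x 1) 0 n r = B 0 n * (r : ℂ) ^ n) := by
  have hconst : (2 * (Real.pi : ℂ)) ^ 2 ≠ 0 :=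
    pow_ne_zero _ (mul_ne_zero two_ne_zero (by exact_mod_cast Real.pi_ne_zero))
  have hco := SolidTorus.ae_torusFourierCoeff_eq_componentCoeff F
  set N : ℂ := (2 * (Real.pi : ℂ)) ^ 2 with hN
  constructor
  · intro hF
    have hw := SolidTorus.isWeakRadialSolution_componentCoeff hF
    have hi := SolidTorus.integrableOn_mul_componentCoeff F
    -- The condition `m ≠ 0` sits under the existential so that the chosen constants are total
    -- functions; the values `0` at `m = 0` are placeholders.
    have hb : ∀ m n : ℤ, ∃ A B : ℂ, m ≠ 0 → ∀ᵐ r : ℝ ∂(volume.restrict (Set.Ioc 0 1)),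
        SolidTorus.componentCoeff F 0 m (n + 1) r =
          ((m : ℂ) / ((|(m : ℝ)| : ℝ) : ℂ)) *
            (-A * (SolidTorus.besselI (n + 1) (|(m : ℝ)| * r) : ℂ)
              + B * (SolidTorus.besselK (n + 1) (|(m : ℝ)| * r) : ℂ)) ∧
        SolidTorus.componentCoeff F 1 m n r =
          A * (SolidTorus.besselI n (|(m : ℝ)| * r) : ℂ)
            + B * (SolidTorus.besselK n (|(m : ℝ)| * r) : ℂ) := fun m n => by
      by_cases hm : m = 0
      · exact ⟨0, 0, fun h => absurd hm h⟩
      · obtain ⟨A, B, h⟩ := (hw m n).exists_bessel hm (hi 0 m (n + 1)) (hi 1 m n)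
        exact ⟨A, B, fun _ => h⟩
    choose A B hAB using hb
    choose a b hab using fun n => (hw 0 n).exists_zpow (hi 0 0 (n + 1)) (hi 1 0 n)
    -- The factor `1 / N` restores the normalization of the coefficients. The shift to `n - 1` is
    -- needed because the radial pair of index `n` contains `f_{0,n+1}`.
    refine ⟨fun m n => if m = 0 then 1 / N * a (n - 1) else 1 / N * A m n,
      fun m n => if m = 0 then 1 / N * b n else 1 / N * B m n, fun m hm n => ?_, fun n => ?_⟩
    · filter_upwards [hAB m n hm, hco 0 m (n + 1), hco 1 m n] with r hr h0 h1
      simp only [if_neg hm]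
      rw [h0, h1, hr.1, hr.2]
      constructor <;> ring
    · filter_upwards [hab (n - 1), hab n, hco 0 0 n, hco 1 0 n] with r hr hr' h0 h1
      rw [sub_add_cancel] at hr
      simp only [if_true]
      rw [h0, h1, hr.1, hr'.2]
      constructor <;> ring
  · rintro ⟨A, B, h1, h2⟩
    refine SolidTorus.mem_diracKernel_of_isRadialSolution fun m n => ?_
    by_cases hm : m = 0
    · subst hm
      refine ⟨_, _, (SolidTorus.isRadialSolution_zpow n (A 0 (n + 1)) (B 0 n)).const_mul N, ?_⟩
      filter_upwards [h2 n, h2 (n + 1), hco 0 0 (n + 1), hco 1 0 n] with r hr hr' h0 h1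
      rw [← hr.2, ← hr'.1, h0, h1]
      constructor <;> field_simp
    · refine ⟨_, _, (SolidTorus.isRadialSolution_bessel hm n (A m n) (B m n)).const_mul N, ?_⟩
      filter_upwards [h1 m hm n, hco 0 m (n + 1), hco 1 m n] with r hr h0 h1
      rw [← hr.1, ← hr.2, h0, h1]
      constructor <;> field_simp
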